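/- Let $d \geq 2$, $\theta \in (0,\pi)$ and $\mu \in (-1, \sqrt{2}-1)$, and let $\mathrm{S}_\theta := \{ z \in \mathbb{C} \setminus \{0\} : |\arg z| < \theta \}$. Then there exists a constant $C > 0$, depending only on $d$, $\mu$ and $\theta$, with the following property. Let $\Omega \subset \mathbb{R}^d$ be a bounded, convex domain with smooth boundary and outward unit normal $n$, and let $\mathcal{Q} \subset \mathbb{R}^d$ be an open cube with sides parallel to the axes and diameter $R > 0$ such that $\mathcal{Q} \cap \Omega \neq \emptyset$. Denote by $2\mathcal{Q}$ the cube with the same center and diameter $2R$. Let $\lambda \in \mathrm{S}_\theta$, and let $u : (2\mathcal{Q}) \cap \Omega \to \mathbb{C}^d$ and $\phi : (2\mathcal{Q}) \cap \Omega \to \mathbb{C}$ be smooth up to the boundary (i.e., restrictions of $\mathrm{C}^\infty$-functions on $\mathbb{R}^d$) with $$\lambda u - \Delta u + \nabla \phi = 0 \quad\text{and}\quad \operatorname{div}(u) = 0 \qquad \text{in } (2\mathcal{Q}) \cap \Omega,$$ $$\{ D u + \mu [D u]^{\top} \} n - \phi n = 0 \qquad \text{on } (2\mathcal{Q}) \cap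 \partial\Omega,$$ where $D u = (\partial_k u_i)_{i,k=1}^d$ (row $i$, column $k$) is the Jacobi matrix of $u$. Then $$|\lambda| \int_{\mathcal{Q} \cap \Omega} |\nabla u|^2 \, dx + \int_{\mathcal{Q} \cap \Omega} |\nabla^2 u|^2 \, dx + \int_{\mathcal{Q} \cap \Omega} |\nabla \phi|^2 \, dx \leq C \bigg( |\lambda|^2 \int_{(2\mathcal{Q}) \cap \Omega} |u|^2 \, dx + \frac{1}{R^2} \int_{(2\mathcal{Q}) \cap \Omega} \big( |\nabla u|^2 + |\phi|^2 \big) \, dx \bigg).$$ -/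

import Mathlib

open scoped ContDiff

noncomputable section

namespace StokesNeumann

/-- The open sector `{z ≠ 0 : |arg z| < θ}` of the complex plane, for `0 < θ < π`. -/
def sector (θ : ℝ) : Set ℂ := {z | z ≠ 0 ∧ |Complex.arg z| < θ}

/-- The open cube in `ℝ^d` with sides parallel to the axes, center `c` and diameter `R`
(hence with side length `R / √d`). Its concentric dilation by the factor `2` is `cube c (2 * R)`. -/
def cube {d : ℕ} (c : EuclideanSpace ℝ (Fin d)) (R : ℝ) : Set (EuclideanSpace ℝ (Fin d)) :=
  {x | ∀ i, |x i - c i| < R / (2 * √(d : ℝ))}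

/-- `ρ` is a smooth function which defines `Ω` in the open neighborhood `V` of `p`:
it has no critical point in `V`, and `Ω ∩ V = {ρ < 0} ∩ V`. -/
structure IsLocalDefiningFunction {d : ℕ} (Ω : Set (EuclideanSpace ℝ (Fin d)))
    (p : EuclideanSpace ℝ (Fin d)) (V : Set (EuclideanSpace ℝ (Fin d)))
    (ρ : EuclideanSpace ℝ (Fin d) → ℝ) : Prop where
  isOpen : IsOpen V
  mem : p ∈ V
  contDiff : ContDiff ℝ ∞ ρ
  gradient_ne_zero : ∀ y ∈ V, gradient ρ y ≠ 0
  mem_iff : ∀ y ∈ V, y ∈ Ω ↔ ρ y < 0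

/-- `Ω` has a smooth boundary: near each of its boundary points it lies on one side of a smooth
hypersurface. -/
def HasSmoothBoundary {d : ℕ} (Ω : Set (EuclideanSpace ℝ (Fin d))) : Prop :=
  ∀ p ∈ frontier Ω, ∃ V ρ, IsLocalDefiningFunction Ω p V ρ

/-- `n` is the outward unit normal to `Ω` at the boundary point `p`, that is, `∇ρ(p) / |∇ρ(p)|` for
a local defining function `ρ` of `Ω` at `p` (this vector does not depend on the choice of `ρ`). -/
def IsOutwardUnitNormal {d : ℕ} (Ω : Set (EuclideanSpace ℝ (Fin d)))
    (p n : EuclideanSpace ℝ (Fin d)) : Prop :=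
  p ∈ frontier Ω ∧ ∃ V ρ, IsLocalDefiningFunction Ω p V ρ ∧
    n = ‖gradient ρ p‖⁻¹ • gradient ρ p

/-- The partial derivative `∂_j f` of a complex valued function on `ℝ^d`. -/
def pderiv {d : ℕ} (j : Fin d) (f : EuclideanSpace ℝ (Fin d) → ℂ) :
    EuclideanSpace ℝ (Fin d) → ℂ :=
  fun x => fderiv ℝ f x (EuclideanSpace.single j 1)

/-- The component `u_k` of a vector field. -/
def comp {d : ℕ} (u : EuclideanSpace ℝ (Fin d) → EuclideanSpace ℂ (Fin d)) (k : Fin d) :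
    EuclideanSpace ℝ (Fin d) → ℂ :=
  fun x => u x k

/-- The Jacobi matrix of `u`, with the entry `∂_k u_i` in row `i` and column `k`. -/
def jacobian {d : ℕ} (u : EuclideanSpace ℝ (Fin d) → EuclideanSpace ℂ (Fin d))
    (x : EuclideanSpace ℝ (Fin d)) : Matrix (Fin d) (Fin d) ℂ :=
  Matrix.of fun i k => pderiv k (comp u i) x

/-- The divergence of `u`. -/
def divergence {d : ℕ} (u : EuclideanSpace ℝ (Fin d) → EuclideanSpace ℂ (Fin d))
    (x : EuclideanSpace ℝ (Fin d)) : ℂ :=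
  ∑ k, pderiv k (comp u k) x

/-- `|∇φ(x)|²` for a scalar function `φ`. -/
def normSqGrad {d : ℕ} (φ : EuclideanSpace ℝ (Fin d) → ℂ) (x : EuclideanSpace ℝ (Fin d)) : ℝ :=
  ∑ j, ‖pderiv j φ x‖ ^ 2

/-- `|∇u(x)|²` for a vector field `u`, the sum of all `|∂_j u_k(x)|²`. -/
def normSqGradVec {d : ℕ} (u : EuclideanSpace ℝ (Fin d) → EuclideanSpace ℂ (Fin d))
    (x : EuclideanSpace ℝ (Fin d)) : ℝ :=
  ∑ k, ∑ j, ‖pderiv j (comp u k) x‖ ^ 2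

/-- `|∇²u(x)|²` for a vector field `u`, the sum of all `|∂_i ∂_j u_k(x)|²`. -/
def normSqHessVec {d : ℕ} (u : EuclideanSpace ℝ (Fin d) → EuclideanSpace ℂ (Fin d))
    (x : EuclideanSpace ℝ (Fin d)) : ℝ :=
  ∑ k, ∑ i, ∑ j, ‖pderiv i (pderiv j (comp u k)) x‖ ^ 2

/-- `u` and `φ` solve `λ u - Δ u + ∇ φ = 0` and `div u = 0` in the open set `U`. -/
def SolvesStokesResolvent {d : ℕ} (lam : ℂ) (U : Set (EuclideanSpace ℝ (Fin d)))
    (u : EuclideanSpace ℝ (Fin d) → EuclideanSpace ℂ (Fin d))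
    (φ : EuclideanSpace ℝ (Fin d) → ℂ) : Prop :=
  ∀ x ∈ U, (∀ k, lam * comp u k x - Laplacian.laplacian (comp u k) x + pderiv k φ x = 0) ∧
    divergence u x = 0

/-- The Neumann-type condition `{Du + μ [Du]ᵀ} n - φ n = 0` on the part `S` of the boundary of `Ω`,
where `n` is the outward unit normal to `Ω`. -/
def NeumannCondition {d : ℕ} (μ : ℝ) (Ω S : Set (EuclideanSpace ℝ (Fin d)))
    (u : EuclideanSpace ℝ (Fin d) → EuclideanSpace ℂ (Fin d))
    (φ : EuclideanSpace ℝ (Fin d) → ℂ) : Prop :=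
  ∀ x ∈ S, ∀ n : EuclideanSpace ℝ (Fin d), IsOutwardUnitNormal Ω x n →
    (jacobian u x + (μ : ℂ) • (jacobian u x).transpose).mulVec (fun k => (n k : ℂ))
      - φ x • (fun k => (n k : ℂ)) = 0

end StokesNeumann

end

namespace StokesNeumann

open MeasureTheory Filter Topology

/-! Let `T = Du + μ[Du]ᵀ - φI` be the stress tensor. The equations say that row `i` of `T` has
divergence `λ u_i`, and the boundary condition says that each row is tangential to `∂Ω`. For a field
`v` tangential to the boundary of a convex domain, the integral of `|div v|² - Re ∂_k v_l conj(∂_l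
v_k)` equals a boundary integral of the second fundamental form in the direction `v`, hence is
nonnegative. This is `integral_contraction_le_integral_divergence_sq`, passed to complex fields by
`integral_contraction_complex_nonneg`.

Apply this to the rows of `ηT`, where `η` is a cutoff. The divergence part is `|ηλu + T∇η|²`, which
the right-hand side of the theorem controls. The contraction of `∇T` with its transpose is computed
in `sum_stressDeriv_contraction`: it is `|∇²u|²`, plus `2μ + μ² = (1+μ)² - 1` times a cross term
bounded by `|∇²u|²`, plus `(1 - 2μ)|∇φ|²`, minus a term that pairs `λu` with `∇φ`. For `-1 < μ < √2
- 1` one has `|2μ + μ²| < 1` and `1 - 2μ > 0`, so the contraction controls `|∇²u|² + |∇φ|²` up to a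
multiple of `|λu|²`. Terms with derivatives of `η` are absorbed by Young's inequality.

The term `|λ||∇u|²` comes from an energy identity: the field `η² Σ_i conj(u_i) T_i` is tangential,
so its divergence integrates to zero. The real part of that divergence contains `η²` times a form
bounded below by `(1 - |μ|)|∇u|²`; after multiplication by `|λ|` the remaining terms are bounded by
`|λ|²|u|²` and `|∇η|²|T|²`.

Both estimates hold pointwise under the integral (`exists_pointwise_bound`). They are integrated in
`exists_local_estimate`, and `exists_cutoff` supplies an `η` with `|∇η|² ≤ M/R²`. -/

/-- The partial derivative `∂_j f` of a function with values in a real normed space. -/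
noncomputable def pd {d : ℕ} {F : Type*} [NormedAddCommGroup F] [NormedSpace ℝ F] (j : Fin d)
    (f : EuclideanSpace ℝ (Fin d) → F) : EuclideanSpace ℝ (Fin d) → F :=
  fun x => fderiv ℝ f x (EuclideanSpace.single j 1)

/-! ### Calculus of partial derivatives and integration by parts on the whole space. -/

section PartialDerivatives

variable {d : ℕ} {F : Type*} [NormedAddCommGroup F] [NormedSpace ℝ F]

theorem pderiv_eq_pd (j : Fin d) (f : EuclideanSpace ℝ (Fin d) → ℂ) : pderiv j f = pd j f := rfl

theorem contDiff_pd {j : Fin d} {f : EuclideanSpace ℝ (Fin d) → F} (hf : ContDiff ℝ ∞ f) :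
    ContDiff ℝ ∞ (pd j f) :=
  (hf.fderiv_right (m := ∞) (by simp)).clm_apply contDiff_const

theorem differentiableAt_of_contDiff_infty {f : EuclideanSpace ℝ (Fin d) → F}
    (hf : ContDiff ℝ ∞ f) (x : EuclideanSpace ℝ (Fin d)) : DifferentiableAt ℝ f x :=
  hf.differentiable (by simp) x

theorem fderiv_apply_eq_sum_pd (f : EuclideanSpace ℝ (Fin d) → F)
    (x v : EuclideanSpace ℝ (Fin d)) : fderiv ℝ f x v = ∑ k, v k • pd k f x := by
  have hv : v = ∑ k, v k • EuclideanSpace.single k (1 : ℝ) := by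
    ext i
    simp [Finset.sum_apply, Pi.single_apply]
  conv_lhs => rw [hv]
  simp [pd]

theorem pd_zero_of_notMem_tsupport {j : Fin d} {f : EuclideanSpace ℝ (Fin d) → F}
    {x : EuclideanSpace ℝ (Fin d)} (hx : x ∉ tsupport f) : pd j f x = 0 := by
  have : fderiv ℝ f x = 0 := by
    by_contra h
    exact hx (support_fderiv_subset ℝ h)
  simp [pd, this]

theorem tsupport_pd_subset (j : Fin d) (f : EuclideanSpace ℝ (Fin d) → F) :
    tsupport (pd j f) ⊆ tsupport f :=
  closure_minimal (fun x hx => by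
    by_contra h
    exact hx (pd_zero_of_notMem_tsupport h)) (isClosed_tsupport f)

theorem hasCompactSupport_pd {j : Fin d} {f : EuclideanSpace ℝ (Fin d) → F}
    (hf : HasCompactSupport f) : HasCompactSupport (pd j f) :=
  hf.mono' (subset_closure.trans (tsupport_pd_subset j f))

theorem pd_congr {j : Fin d} {f g : EuclideanSpace ℝ (Fin d) → F}
    {U : Set (EuclideanSpace ℝ (Fin d))} (hU : IsOpen U) (h : ∀ x ∈ U, f x = g x)
    {x : EuclideanSpace ℝ (Fin d)} (hx : x ∈ U) : pd j f x = pd j g x := by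
  have : f =ᶠ[𝓝 x] g := eventually_of_mem (hU.mem_nhds hx) h
  simp [pd, this.fderiv_eq]

@[simp] theorem pd_const (j : Fin d) (c : F) (x : EuclideanSpace ℝ (Fin d)) :
    pd j (fun _ => c) x = 0 := by
  simp [pd]

theorem pd_add {j : Fin d} {f g : EuclideanSpace ℝ (Fin d) → F} (hf : ContDiff ℝ ∞ f)
    (hg : ContDiff ℝ ∞ g) (x : EuclideanSpace ℝ (Fin d)) :
    pd j (fun y => f y + g y) x = pd j f x + pd j g x := by
  simp [pd, fderiv_fun_add (differentiableAt_of_contDiff_infty hf x)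
    (differentiableAt_of_contDiff_infty hg x)]

theorem pd_sub {j : Fin d} {f g : EuclideanSpace ℝ (Fin d) → F} (hf : ContDiff ℝ ∞ f)
    (hg : ContDiff ℝ ∞ g) (x : EuclideanSpace ℝ (Fin d)) :
    pd j (fun y => f y - g y) x = pd j f x - pd j g x := by
  simp [pd, fderiv_fun_sub (differentiableAt_of_contDiff_infty hf x)
    (differentiableAt_of_contDiff_infty hg x)]

theorem pd_sum {ι : Type*} {s : Finset ι} {j : Fin d} {f : ι → EuclideanSpace ℝ (Fin d) → F}
    (hf : ∀ i, ContDiff ℝ ∞ (f i)) (x : EuclideanSpace ℝ (Fin d)) :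
    pd j (fun y => ∑ i ∈ s, f i y) x = ∑ i ∈ s, pd j (f i) x := by
  simp [pd, fderiv_fun_sum (fun i _ => differentiableAt_of_contDiff_infty (hf i) x)]

theorem pd_mul {A : Type*} [NormedCommRing A] [NormedAlgebra ℝ A] {j : Fin d}
    {f g : EuclideanSpace ℝ (Fin d) → A} (hf : ContDiff ℝ ∞ f)
    (hg : ContDiff ℝ ∞ g) (x : EuclideanSpace ℝ (Fin d)) :
    pd j (fun y => f y * g y) x = pd j f x * g x + f x * pd j g x := by
  simp [pd, fderiv_fun_mul (differentiableAt_of_contDiff_infty hf x)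
    (differentiableAt_of_contDiff_infty hg x)]
  ring

theorem pd_clm_comp {G : Type*} [NormedAddCommGroup G] [NormedSpace ℝ G] {j : Fin d}
    (L : F →L[ℝ] G) {f : EuclideanSpace ℝ (Fin d) → F} (hf : ContDiff ℝ ∞ f)
    (x : EuclideanSpace ℝ (Fin d)) : pd j (fun y => L (f y)) x = L (pd j f x) := by
  have := L.hasFDerivAt.comp x (differentiableAt_of_contDiff_infty hf x).hasFDerivAt
  have h2 : fderiv ℝ (fun y => L (f y)) x = L.comp (fderiv ℝ f x) := this.fderiv
  simp [pd, h2]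

theorem pd_re {j : Fin d} {f : EuclideanSpace ℝ (Fin d) → ℂ} (hf : ContDiff ℝ ∞ f)
    (x : EuclideanSpace ℝ (Fin d)) : pd j (fun y => (f y).re) x = (pd j f x).re :=
  pd_clm_comp Complex.reCLM hf x

theorem pd_im {j : Fin d} {f : EuclideanSpace ℝ (Fin d) → ℂ} (hf : ContDiff ℝ ∞ f)
    (x : EuclideanSpace ℝ (Fin d)) : pd j (fun y => (f y).im) x = (pd j f x).im :=
  pd_clm_comp Complex.imCLM hf x

theorem pd_conj {j : Fin d} {f : EuclideanSpace ℝ (Fin d) → ℂ} (hf : ContDiff ℝ ∞ f)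
    (x : EuclideanSpace ℝ (Fin d)) :
    pd j (fun y => (starRingEnd ℂ) (f y)) x = (starRingEnd ℂ) (pd j f x) :=
  pd_clm_comp (Complex.conjCLE : ℂ →L[ℝ] ℂ) hf x

theorem pd_ofReal {j : Fin d} {f : EuclideanSpace ℝ (Fin d) → ℝ} (hf : ContDiff ℝ ∞ f)
    (x : EuclideanSpace ℝ (Fin d)) : pd j (fun y => (f y : ℂ)) x = ((pd j f x : ℝ) : ℂ) :=
  pd_clm_comp Complex.ofRealCLM hf x

theorem pd_comm {j k : Fin d} {f : EuclideanSpace ℝ (Fin d) → F} (hf : ContDiff ℝ ∞ f)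
    (x : EuclideanSpace ℝ (Fin d)) : pd j (pd k f) x = pd k (pd j f) x := by
  have hd : DifferentiableAt ℝ (fderiv ℝ f) x :=
    (hf.fderiv_right (m := ∞) (by simp)).differentiable (by simp) x
  have key : ∀ v w : EuclideanSpace ℝ (Fin d),
      fderiv ℝ (fun y => fderiv ℝ f y v) x w = fderiv ℝ (fderiv ℝ f) x w v := by
    intro v w
    rw [fderiv_clm_apply hd (differentiableAt_const v)]
    simp
  have hs : IsSymmSndFDerivAt ℝ f x :=
    (contDiff_infty.1 hf 2).contDiffAt.isSymmSndFDerivAt (by simp)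
  change fderiv ℝ (fun y => fderiv ℝ f y _) x _ = fderiv ℝ (fun y => fderiv ℝ f y _) x _
  rw [key, key]
  exact hs _ _

theorem laplacian_eq_sum_pd {f : EuclideanSpace ℝ (Fin d) → F} (hf : ContDiff ℝ ∞ f)
    (x : EuclideanSpace ℝ (Fin d)) : Laplacian.laplacian f x = ∑ k, pd k (pd k f) x := by
  have hd : DifferentiableAt ℝ (fderiv ℝ f) x :=
    (hf.fderiv_right (m := ∞) (by simp)).differentiable (by simp) x
  rw [InnerProductSpace.laplacian_eq_iteratedFDeriv_orthonormalBasis f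
    (EuclideanSpace.basisFun (Fin d) ℝ)]
  refine Finset.sum_congr rfl fun k _ => ?_
  rw [iteratedFDeriv_two_apply]
  change _ = fderiv ℝ (fun y => fderiv ℝ f y _) x _
  rw [fderiv_clm_apply hd (differentiableAt_const _)]
  simp

theorem integral_mul_pd {f g : EuclideanSpace ℝ (Fin d) → ℝ} (hf : ContDiff ℝ ∞ f)
    (hg : ContDiff ℝ ∞ g) (hc : HasCompactSupport g) (j : Fin d) :
    ∫ x, f x * pd j g x = -∫ x, pd j f x * g x := by
  apply integral_mul_fderiv_eq_neg_fderiv_mul_of_integrable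
  · exact ((contDiff_pd hf).continuous.mul hg.continuous).integrable_of_hasCompactSupport
      hc.mul_left
  · exact (hf.continuous.mul (contDiff_pd hg).continuous).integrable_of_hasCompactSupport
      (hasCompactSupport_pd (j := j) hc).mul_left
  · exact (hf.continuous.mul hg.continuous).integrable_of_hasCompactSupport hc.mul_left
  · exact fun x _ => differentiableAt_of_contDiff_infty hf x
  · exact fun x _ => differentiableAt_of_contDiff_infty hg x

theorem integral_pd_eq_zero {g : EuclideanSpace ℝ (Fin d) → ℝ}
    (hg : ContDiff ℝ ∞ g) (hc : HasCompactSupport g) (j : Fin d) : ∫ x, pd j g x = 0 := by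
  simpa using integral_mul_pd (contDiff_const (c := (1 : ℝ))) hg hc j

theorem gradient_apply_eq_pd (f : EuclideanSpace ℝ (Fin d) → ℝ)
    (x : EuclideanSpace ℝ (Fin d)) (k : Fin d) : gradient f x k = pd k f x := by
  have : inner ℝ (gradient f x) (EuclideanSpace.single k (1 : ℝ)) = pd k f x := by
    simp [gradient, pd]
  rw [← this, EuclideanSpace.inner_single_right]
  simp

end PartialDerivatives

/-! ### The divergence theorem on smooth domains, without surface measure. -/

section Divergence

variable {d : ℕ}

/-- A zero of `ρ` outside the closure of `Ω` would be a local minimum of `ρ`, which the nonvanishing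
gradient forbids. -/
theorem IsLocalDefiningFunction.mem_frontier {Ω V : Set (EuclideanSpace ℝ (Fin d))}
    {p y : EuclideanSpace ℝ (Fin d)} {ρ : EuclideanSpace ℝ (Fin d) → ℝ}
    (h : IsLocalDefiningFunction Ω p V ρ) (hy : y ∈ V) (hρ : ρ y = 0) : y ∈ frontier Ω := by
  rw [frontier_eq_closure_inter_closure]
  refine ⟨?_, subset_closure fun hyΩ => ?_⟩
  · by_contra hcl
    have hev : ∀ᶠ z in 𝓝 y, z ∈ (closure Ω)ᶜ ∩ V :=
      (isClosed_closure.isOpen_compl.inter h.isOpen).mem_nhds ⟨hcl, hy⟩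
    have hmin : IsLocalMin ρ y := by
      filter_upwards [hev] with z hz
      rw [hρ]
      by_contra! hlt
      exact hz.1 (subset_closure ((h.mem_iff z hz.2).2 hlt))
    exact h.gradient_ne_zero y hy (by simp [gradient, hmin.fderiv_eq_zero])
  · have := (h.mem_iff y hy).1 hyΩ
    linarith

theorem IsLocalDefiningFunction.eq_zero_of_mem_frontier {Ω V : Set (EuclideanSpace ℝ (Fin d))}
    {p y : EuclideanSpace ℝ (Fin d)} {ρ : EuclideanSpace ℝ (Fin d) → ℝ}
    (h : IsLocalDefiningFunction Ω p V ρ) (hΩ : IsOpen Ω) (hy : y ∈ V) (hf : y ∈ frontier Ω) :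
    ρ y = 0 := by
  rw [hΩ.frontier_eq] at hf
  have h1 : 0 ≤ ρ y := by
    by_contra! hlt
    exact hf.2 ((h.mem_iff y hy).2 hlt)
  refine le_antisymm ?_ h1
  by_contra! hlt
  have hev : ∀ᶠ z in 𝓝 y, z ∈ V ∧ 0 < ρ z :=
    (h.isOpen.eventually_mem hy).and (h.contDiff.continuous.continuousAt.eventually (lt_mem_nhds hlt))
  obtain ⟨z, hz, hzΩ⟩ := mem_closure_iff_nhds.1 hf.1 _ hev
  have := (h.mem_iff z hz.1).1 hzΩ
  linarith [hz.2]

theorem IsLocalDefiningFunction.of_mem {Ω V : Set (EuclideanSpace ℝ (Fin d))}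
    {p y : EuclideanSpace ℝ (Fin d)} {ρ : EuclideanSpace ℝ (Fin d) → ℝ}
    (h : IsLocalDefiningFunction Ω p V ρ) (hy : y ∈ V) : IsLocalDefiningFunction Ω y V ρ :=
  ⟨h.isOpen, hy, h.contDiff, h.gradient_ne_zero, h.mem_iff⟩

/-- Near a boundary point, the distance to the boundary is controlled by `|ρ|`. -/
theorem IsLocalDefiningFunction.exists_near {Ω V : Set (EuclideanSpace ℝ (Fin d))}
    {p : EuclideanSpace ℝ (Fin d)} {ρ : EuclideanSpace ℝ (Fin d) → ℝ}
    (h : IsLocalDefiningFunction Ω p V ρ) (hΩ : IsOpen Ω) (hp : p ∈ frontier Ω) :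
    ∃ U, IsOpen U ∧ p ∈ U ∧ U ⊆ V ∧ ∃ C : ℝ, 0 ≤ C ∧ ∀ x ∈ U, ∃ y ∈ frontier Ω, y ∈ V ∧
      ‖x - y‖ ≤ C * |ρ x| := by
  have hρp : ρ p = 0 := h.eq_zero_of_mem_frontier hΩ h.mem hp
  -- Near `p`, `ρ` grows at rate at least `m` along the fixed direction `∇ρ(p)`, so the line through
  -- `x` in that direction meets `{ρ = 0}` at a parameter of size at most `|ρ x| / m`.
  set e := gradient ρ p with he
  have hene : e ≠ 0 := h.gradient_ne_zero p h.mem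
  have hepos : 0 < ‖e‖ := norm_pos_iff.2 hene
  have hdiff : Differentiable ℝ ρ := h.contDiff.differentiable (by simp)
  have hder : Continuous fun x => fderiv ℝ ρ x e :=
    (h.contDiff.continuous_fderiv (by simp)).clm_apply continuous_const
  have hdp : fderiv ℝ ρ p e = ‖e‖ ^ 2 := by
    have : inner ℝ (gradient ρ p) e = fderiv ℝ ρ p e := by simp [gradient]
    rw [← this, ← he, real_inner_self_eq_norm_sq]
  set m := ‖e‖ ^ 2 / 2 with hm
  have hmpos : 0 < m := by positivity
  have hev : ∀ᶠ x in 𝓝 p, x ∈ V ∧ m < fderiv ℝ ρ x e :=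
    (h.isOpen.eventually_mem h.mem).and
      (hder.continuousAt.eventually (lt_mem_nhds (by
        have := sq_pos_of_pos hepos
        simp only [hdp, hm]
        linarith)))
  obtain ⟨r, hr, hball⟩ := Metric.eventually_nhds_iff_ball.1 hev
  -- This keeps the whole segment of parameters in `[-S, S]` inside the ball where the growth rate
  -- is known.
  have hev2 : ∀ᶠ x in 𝓝 p, |ρ x| / m * ‖e‖ < r / 2 := by
    have hc : Continuous fun x => |ρ x| / m * ‖e‖ :=
      (h.contDiff.continuous.abs.div_const _).mul_const _
    exact hc.continuousAt.eventually (gt_mem_nhds (by simp [hρp, hr]))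
  obtain ⟨s, hs, hball2⟩ := Metric.eventually_nhds_iff_ball.1 hev2
  refine ⟨Metric.ball p (min s (r / 2)), Metric.isOpen_ball,
    Metric.mem_ball_self (lt_min hs (by linarith)), fun x hx => (hball x ?_).1, ‖e‖ / m,
    by positivity, fun x hx => ?_⟩
  · exact Metric.ball_subset_ball ((min_le_right _ _).trans (by linarith)) hx
  have hxs := hball2 x (Metric.ball_subset_ball (min_le_left _ _) hx)
  have hxr : dist x p < r / 2 := Metric.ball_subset_ball (min_le_right _ _) hx
  set S := |ρ x| / m with hS
  have hS0 : 0 ≤ S := by positivity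
  have hmem : ∀ t ∈ Set.Icc (-S) S, x + t • e ∈ Metric.ball p r := by
    intro t ht
    rw [Metric.mem_ball]
    calc dist (x + t • e) p ≤ dist (x + t • e) x + dist x p := dist_triangle _ _ _
      _ = |t| * ‖e‖ + dist x p := by simp [dist_eq_norm, norm_smul]
      _ ≤ S * ‖e‖ + dist x p := by
          gcongr
          exact abs_le.2 ht
      _ < r := by linarith
  have hderiv : ∀ t, HasDerivAt (fun t : ℝ => ρ (x + t • e)) (fderiv ℝ ρ (x + t • e) e) t := by
    intro t
    have h1 : HasDerivAt (fun t : ℝ => x + t • e) e t := by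
      simpa using ((hasDerivAt_id t).smul_const e).const_add x
    exact (hdiff _).hasFDerivAt.comp_hasDerivAt t h1
  have hcont : Continuous fun t : ℝ => ρ (x + t • e) :=
    h.contDiff.continuous.comp (by fun_prop)
  have hgrow : ∀ a ∈ Set.Icc (-S) S, ∀ b ∈ Set.Icc (-S) S, a ≤ b →
      m * (b - a) ≤ ρ (x + b • e) - ρ (x + a • e) := by
    refine Convex.mul_sub_le_image_sub_of_le_deriv (convex_Icc _ _) hcont.continuousOn
      (fun t _ => (hderiv t).differentiableAt.differentiableWithinAt) fun t ht => ?_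
    rw [interior_Icc] at ht
    rw [(hderiv t).deriv]
    exact (hball _ (hmem t (Set.Ioo_subset_Icc_self ht))).2.le
  have hz : (0 : ℝ) ∈ Set.Icc (-S) S := ⟨by linarith, hS0⟩
  have hmS : m * S = |ρ x| := by rw [hS]; field_simp
  have h1 := hgrow 0 hz S ⟨by linarith, le_rfl⟩ hS0
  have h2 := hgrow (-S) ⟨le_rfl, by linarith⟩ 0 hz (by linarith)
  simp only [zero_smul, add_zero, sub_zero] at h1 h2
  obtain ⟨t, ht, hρt⟩ : (0 : ℝ) ∈ (fun t : ℝ => ρ (x + t • e)) '' Set.Icc (-S) S := by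
    refine intermediate_value_Icc (by linarith) hcont.continuousOn ⟨?_, ?_⟩
    · have := le_abs_self (ρ x)
      linarith
    · have := neg_abs_le (ρ x)
      linarith
  have hyV := (hball _ (hmem t ht)).1
  refine ⟨x + t • e, h.mem_frontier hyV hρt, hyV, ?_⟩
  calc ‖x - (x + t • e)‖ = |t| * ‖e‖ := by simp [norm_smul]
    _ ≤ S * ‖e‖ := by
        gcongr
        exact abs_le.2 ht
    _ = ‖e‖ / m * |ρ x| := by rw [hS]; ring

/-- The vector field `W` points outwards, or is tangential, along the part of the boundary of
`Ω`. -/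
def IsOutward (Ω : Set (EuclideanSpace ℝ (Fin d)))
    (W : Fin d → EuclideanSpace ℝ (Fin d) → ℝ) : Prop :=
  ∀ p ∈ frontier Ω, ∀ V ρ, IsLocalDefiningFunction Ω p V ρ → 0 ≤ ∑ k, W k p * pd k ρ p

theorem deriv_smoothTransition_of_neg {s : ℝ} (hs : s < 0) :
    deriv Real.smoothTransition s = 0 := by
  have : Real.smoothTransition =ᶠ[𝓝 s] fun _ => 0 := by
    filter_upwards [gt_mem_nhds hs] with t ht using Real.smoothTransition.zero_of_nonpos ht.le
  simp [this.deriv_eq]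

theorem deriv_smoothTransition_of_one_lt {s : ℝ} (hs : 1 < s) :
    deriv Real.smoothTransition s = 0 := by
  have : Real.smoothTransition =ᶠ[𝓝 s] fun _ => 1 := by
    filter_upwards [lt_mem_nhds hs] with t ht using Real.smoothTransition.one_of_one_le ht.le
  simp [this.deriv_eq]

theorem continuous_deriv_smoothTransition : Continuous (deriv Real.smoothTransition) :=
  (Real.smoothTransition.contDiff (n := 1)).continuous_deriv (by simp)

/-- With `s = -nρ` this dominates the boundary layer `n|ρ| g'(-nρ)` uniformly in `n`: the derivative
lives on `[0, 1]`. -/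
theorem exists_bound_deriv_smoothTransition :
    ∃ M : ℝ, ∀ s, ‖|s| * deriv Real.smoothTransition s‖ ≤ M := by
  have hc := continuous_deriv_smoothTransition
  obtain ⟨M, hM⟩ := isCompact_Icc.exists_bound_of_continuousOn (s := Set.Icc (0 : ℝ) 1)
    (f := fun s => |s| * deriv Real.smoothTransition s) (by fun_prop)
  refine ⟨max M 0, fun s => ?_⟩
  by_cases hs : s ∈ Set.Icc (0 : ℝ) 1
  · exact (hM s hs).trans (le_max_left _ _)
  · have : deriv Real.smoothTransition s = 0 := by
      rcases not_and_or.1 hs with h | h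
      · exact deriv_smoothTransition_of_neg (not_le.1 h)
      · exact deriv_smoothTransition_of_one_lt (not_le.1 h)
    simp [this]

/-- The layer where the cutoff varies has width `1/n`, so it leaves every point `t ≠ 0`; at `t = 0`
the factor `|n t|` vanishes. -/
theorem tendsto_layer_zero (t : ℝ) :
    Tendsto (fun n : ℕ => |-(n * t)| * deriv Real.smoothTransition (-(n * t))) atTop (𝓝 0) := by
  rcases lt_or_ge t 0 with ht | ht
  · obtain ⟨N, hN⟩ := exists_nat_gt (1 / (-t))
    refine tendsto_const_nhds.congr' ?_
    filter_upwards [eventually_ge_atTop N] with n hn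
    have h1 : 1 < -((n : ℝ) * t) := by
      have : 1 / (-t) < n := hN.trans_le (by exact_mod_cast hn)
      rw [div_lt_iff₀ (by linarith)] at this
      linarith
    rw [deriv_smoothTransition_of_one_lt h1, mul_zero]
  · refine tendsto_const_nhds.congr fun n => ?_
    rcases (mul_nonneg (Nat.cast_nonneg (α := ℝ) n) ht).eq_or_lt with h | h
    · simp [← h]
    · rw [deriv_smoothTransition_of_neg (by linarith), mul_zero]

theorem tendsto_cutoff (t : ℝ) :
    Tendsto (fun n : ℕ => Real.smoothTransition (-(n * t))) atTop (𝓝 (if t < 0 then 1 else 0)) := by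
  split_ifs with ht
  · obtain ⟨N, hN⟩ := exists_nat_gt (1 / (-t))
    refine tendsto_const_nhds.congr' ?_
    filter_upwards [eventually_ge_atTop N] with n hn
    have : 1 / (-t) < n := hN.trans_le (by exact_mod_cast hn)
    rw [div_lt_iff₀ (by linarith)] at this
    rw [Real.smoothTransition.one_of_one_le (by linarith)]
  · refine tendsto_const_nhds.congr fun n => ?_
    have := mul_nonneg (Nat.cast_nonneg (α := ℝ) n) (not_lt.1 ht)
    rw [Real.smoothTransition.zero_of_nonpos (by linarith)]

theorem pd_cutoff {ρ : EuclideanSpace ℝ (Fin d) → ℝ} (hρ : ContDiff ℝ ∞ ρ) (c : ℝ) (k : Fin d)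
    (x : EuclideanSpace ℝ (Fin d)) :
    pd k (fun y => Real.smoothTransition (-(c * ρ y))) x =
      -(c * deriv Real.smoothTransition (-(c * ρ x)) * pd k ρ x) := by
  have h1 : HasFDerivAt (fun y => -(c * ρ y)) (-(c • fderiv ℝ ρ x)) x :=
    ((differentiableAt_of_contDiff_infty hρ x).hasFDerivAt.const_mul c).neg
  have h2 := (((Real.smoothTransition.contDiff (n := 1)).differentiable
    (by simp)) (-(c * ρ x))).hasDerivAt
  have h3 := (h2.comp_hasFDerivAt x h1).fderiv
  change fderiv ℝ (Real.smoothTransition ∘ fun y => -(c * ρ y)) x _ = _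
  rw [h3]
  simp [pd]
  ring

/-- The divergence theorem, as an inequality, for fields supported near a boundary point. -/
theorem IsLocalDefiningFunction.exists_integral_divergence_nonneg
    {Ω V : Set (EuclideanSpace ℝ (Fin d))}
    {p : EuclideanSpace ℝ (Fin d)} {ρ : EuclideanSpace ℝ (Fin d) → ℝ}
    (h : IsLocalDefiningFunction Ω p V ρ) (hΩ : IsOpen Ω) (hp : p ∈ frontier Ω) :
    ∃ U, IsOpen U ∧ p ∈ U ∧ ∀ W : Fin d → EuclideanSpace ℝ (Fin d) → ℝ,
      (∀ k, ContDiff ℝ ∞ (W k)) → (∀ k, HasCompactSupport (W k)) → (∀ k, tsupport (W k) ⊆ U) →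
      IsOutward Ω W → 0 ≤ ∫ x in Ω, ∑ k, pd k (W k) x := by
  obtain ⟨U, hU, hpU, hUV, C, hC, hnear⟩ := h.exists_near hΩ hp
  refine ⟨U, hU, hpU, fun W hW hWc hWU hout => ?_⟩
  set K : Set (EuclideanSpace ℝ (Fin d)) := ⋃ k, tsupport (W k) with hK
  have hKc : IsCompact K := isCompact_iUnion hWc
  have hKU : K ⊆ U := Set.iUnion_subset hWU
  have hWK : ∀ x ∉ K, ∀ k, W k x = 0 := fun x hx k =>
    image_eq_zero_of_notMem_tsupport fun hk => hx (Set.mem_iUnion.2 ⟨k, hk⟩)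
  have hdK : ∀ x ∉ K, ∀ k, pd k (W k) x = 0 := fun x hx k =>
    pd_zero_of_notMem_tsupport fun hk => hx (Set.mem_iUnion.2 ⟨k, hk⟩)
  set D : EuclideanSpace ℝ (Fin d) → ℝ := fun x => ∑ k, pd k (W k) x with hD
  have hDcont : Continuous D := continuous_finsetSum _ fun k _ => (contDiff_pd (hW k)).continuous
  have hDc : HasCompactSupport D :=
    HasCompactSupport.intro hKc fun x hx => by simp [hD, hdK x hx]
  have hDint : Integrable D := hDcont.integrable_of_hasCompactSupport hDc
  set F : EuclideanSpace ℝ (Fin d) → ℝ := fun x => ∑ k, W k x * pd k ρ x with hF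
  have hFs : ContDiff ℝ ∞ F := ContDiff.sum fun k _ => (hW k).mul (contDiff_pd h.contDiff)
  have hFK : ∀ x ∉ K, F x = 0 := fun x hx => by simp [hF, hWK x hx]
  have hFc : HasCompactSupport F := HasCompactSupport.intro hKc hFK
  obtain ⟨L, hL⟩ := hFs.lipschitzWith_of_hasCompactSupport hFc (by simp)
  -- The flux `F = W·∇ρ` is nonnegative on `∂Ω` and Lipschitz, so its negative part is at most a
  -- multiple of the distance to `∂Ω`, which is at most `C |ρ|`.
  have hFlow : ∀ x ∈ K, -(L * C * |ρ x|) ≤ F x := by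
    intro x hx
    obtain ⟨y, hyf, hyV, hxy⟩ := hnear x (hKU hx)
    have h0 : 0 ≤ F y := hout y hyf V ρ (h.of_mem hyV)
    have h1 := hL.dist_le_mul x y
    rw [Real.dist_eq, dist_eq_norm] at h1
    have h2 : (L : ℝ) * ‖x - y‖ ≤ L * (C * |ρ x|) := by gcongr
    have h3 := neg_abs_le (F x - F y)
    linarith
  set g' := deriv Real.smoothTransition with hg'
  have hg'0 : ∀ s, 0 ≤ g' s := fun s => Real.smoothTransition.monotone.deriv_nonneg
  have hg'c : Continuous g' := continuous_deriv_smoothTransition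
  have hρc : Continuous ρ := h.contDiff.continuous
  -- On `K`, `χ n` tends to the indicator of `Ω`. Integration by parts turns `∫ χ n · div W` into `∫
  -- n g'(-nρ) F`, which is at least `-LC ∫ n|ρ| g'(-nρ)`, and this bound tends to zero by dominated
  -- convergence.
  set χ : ℕ → EuclideanSpace ℝ (Fin d) → ℝ :=
    fun n x => Real.smoothTransition (-(n * ρ x)) with hχ
  have hχs : ∀ n, ContDiff ℝ ∞ (χ n) := fun n =>
    Real.smoothTransition.contDiff.comp (contDiff_const.mul h.contDiff).neg
  have hlim1 : Tendsto (fun n => ∫ x, χ n x * D x) atTop (𝓝 (∫ x in Ω, D x)) := by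
    rw [← integral_indicator hΩ.measurableSet]
    refine tendsto_integral_of_dominated_convergence (fun x => ‖D x‖)
      (fun n => ((hχs n).continuous.mul hDcont).aestronglyMeasurable) hDint.norm
      (fun n => Eventually.of_forall fun x => ?_) (Eventually.of_forall fun x => ?_)
    · rw [norm_mul, Real.norm_of_nonneg (Real.smoothTransition.nonneg _)]
      exact mul_le_of_le_one_left (norm_nonneg _) (Real.smoothTransition.le_one _)
    · by_cases hx : x ∈ K
      · have := (tendsto_cutoff (ρ x)).mul_const (D x)
        convert this using 2
        by_cases hxΩ : x ∈ Ω
        · simp [hxΩ, (h.mem_iff x (hUV (hKU hx))).1 hxΩ]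
        · have h3 : ¬ ρ x < 0 := fun h4 => hxΩ ((h.mem_iff x (hUV (hKU hx))).2 h4)
          simp [hxΩ, h3]
      · have h0 : D x = 0 := by simp [hD, hdK x hx]
        by_cases hxΩ : x ∈ Ω <;> simp [hxΩ, h0]
  have hibp : ∀ n : ℕ, ∫ x, χ n x * D x = ∫ x in K, n * g' (-(n * ρ x)) * F x := by
    intro n
    have e1 : ∫ x, χ n x * D x = ∑ k, ∫ x, χ n x * pd k (W k) x := by
      rw [← integral_finsetSum]
      · simp only [hD, Finset.mul_sum]
      · intro k _
        exact ((hχs n).continuous.mul (contDiff_pd (hW k)).continuous).integrable_of_hasCompactSupport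
          (hasCompactSupport_pd (hWc k)).mul_left
    have e2 : ∀ k, ∫ x, χ n x * pd k (W k) x =
        ∫ x, n * g' (-(n * ρ x)) * (W k x * pd k ρ x) := by
      intro k
      rw [integral_mul_pd (hχs n) (hW k) (hWc k), ← integral_neg]
      congr 1 with x
      rw [hχ, pd_cutoff h.contDiff]
      ring
    rw [e1, Finset.sum_congr rfl fun k _ => e2 k, ← integral_finsetSum]
    · rw [setIntegral_eq_integral_of_forall_compl_eq_zero]
      · simp only [hF, Finset.mul_sum]
      · intro x hx
        rw [hFK x hx, mul_zero]
    · intro k _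
      refine Continuous.integrable_of_hasCompactSupport ?_ ((hWc k).mul_right.mul_left)
      have := (hW k).continuous
      have := (contDiff_pd (j := k) h.contDiff).continuous
      fun_prop
  obtain ⟨M, hM⟩ := exists_bound_deriv_smoothTransition
  have hKfin : volume K ≠ ⊤ := hKc.measure_lt_top.ne
  have hlim2 : Tendsto (fun n : ℕ => ∫ x in K, -(L * C) * (|-(n * ρ x)| * g' (-(n * ρ x)))) atTop
      (𝓝 (∫ x in K, (0 : ℝ))) := by
    refine tendsto_integral_of_dominated_convergence (fun _ => L * C * M)
      (fun n => ?_) ?_ (fun n => Eventually.of_forall fun x => ?_)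
      (Eventually.of_forall fun x => ?_)
    · exact Continuous.aestronglyMeasurable (by fun_prop)
    · exact integrableOn_const hKfin
    · rw [norm_mul, norm_neg, Real.norm_of_nonneg (by positivity)]
      exact mul_le_mul_of_nonneg_left (hM _) (by positivity)
    · simpa using (tendsto_layer_zero (ρ x)).const_mul (-(L * C))
  rw [integral_zero] at hlim2
  refine le_of_tendsto_of_tendsto' hlim2 hlim1 fun n => ?_
  rw [hibp n]
  refine setIntegral_mono_on ?_ ?_ hKc.measurableSet fun x hx => ?_
  · exact (Continuous.continuousOn (by fun_prop)).integrableOn_compact hKc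
  · have := hFs.continuous
    exact (Continuous.continuousOn (by fun_prop)).integrableOn_compact hKc
  · have h1 := mul_le_mul_of_nonneg_left (hFlow x hx)
      (mul_nonneg (Nat.cast_nonneg (α := ℝ) n) (hg'0 (-(n * ρ x))))
    rw [abs_neg, abs_mul, Nat.abs_cast]
    calc _ = _ := by ring
      _ ≤ _ := h1

/-- **Divergence theorem**, as an inequality: a compactly supported smooth field which points
outwards on the smooth boundary of `Ω` has a nonnegative total divergence in `Ω`. -/
theorem integral_divergence_nonneg {Ω : Set (EuclideanSpace ℝ (Fin d))} (hΩ : IsOpen Ω)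
    (hs : HasSmoothBoundary Ω) {W : Fin d → EuclideanSpace ℝ (Fin d) → ℝ}
    (hW : ∀ k, ContDiff ℝ ∞ (W k)) (hWc : ∀ k, HasCompactSupport (W k)) (hout : IsOutward Ω W) :
    0 ≤ ∫ x in Ω, ∑ k, pd k (W k) x := by
  -- Every point has a neighborhood in which the claim holds: boundary points by the local result,
  -- interior and exterior points trivially. A partition of unity then glues, since multiplying by a
  -- nonnegative function keeps a field outward.
  have hloc : ∀ p : EuclideanSpace ℝ (Fin d), ∃ U, IsOpen U ∧ p ∈ U ∧
      ∀ W : Fin d → EuclideanSpace ℝ (Fin d) → ℝ,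
      (∀ k, ContDiff ℝ ∞ (W k)) → (∀ k, HasCompactSupport (W k)) → (∀ k, tsupport (W k) ⊆ U) →
      IsOutward Ω W → 0 ≤ ∫ x in Ω, ∑ k, pd k (W k) x := by
    intro p
    by_cases hpf : p ∈ frontier Ω
    · obtain ⟨V, ρ, h⟩ := hs p hpf
      exact h.exists_integral_divergence_nonneg hΩ hpf
    by_cases hpΩ : p ∈ Ω
    · refine ⟨Ω, hΩ, hpΩ, fun W hW hWc hWU _ => ?_⟩
      rw [setIntegral_eq_integral_of_forall_compl_eq_zero, integral_finsetSum]
      · simp [integral_pd_eq_zero (hW _) (hWc _)]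
      · exact fun k _ => (contDiff_pd (hW k)).continuous.integrable_of_hasCompactSupport
          (hasCompactSupport_pd (hWc k))
      · exact fun x hx => Finset.sum_eq_zero fun k _ =>
          pd_zero_of_notMem_tsupport fun hk => hx (hWU k hk)
    · refine ⟨(closure Ω)ᶜ, isClosed_closure.isOpen_compl, fun hc => hpf ?_,
        fun W hW hWc hWU _ => ?_⟩
      · rw [hΩ.frontier_eq]
        exact ⟨hc, hpΩ⟩
      · rw [setIntegral_eq_zero_of_forall_eq_zero]
        exact fun x hx => Finset.sum_eq_zero fun k _ =>
          pd_zero_of_notMem_tsupport fun hk => hWU k hk (subset_closure hx)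
  choose U hUo hpU hUW using hloc
  set K : Set (EuclideanSpace ℝ (Fin d)) := ⋃ k, tsupport (W k) with hK
  have hKc : IsCompact K := isCompact_iUnion hWc
  obtain ⟨t, ht⟩ := hKc.elim_finite_subcover U hUo fun x _ => Set.mem_iUnion.2 ⟨x, hpU x⟩
  obtain ⟨f, hf⟩ := SmoothPartitionOfUnity.exists_isSubordinate
    (modelWithCornersSelf ℝ (EuclideanSpace ℝ (Fin d))) hKc.isClosed
    (fun p : t => U p) (fun p => hUo p) (fun x hx => by
      obtain ⟨p, hp, hxp⟩ := Set.mem_iUnion₂.1 (ht hx)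
      exact Set.mem_iUnion.2 ⟨⟨p, hp⟩, hxp⟩)
  have hfs : ∀ p, ContDiff ℝ ∞ (f p) := fun p => (f p).contMDiff.contDiff
  have hsum : ∀ x, ∀ k, W k x = ∑ p, f p x * W k x := by
    intro x k
    by_cases hx : x ∈ K
    · have := f.sum_eq_one hx
      rw [finsum_eq_sum_of_fintype] at this
      rw [← Finset.sum_mul, this, one_mul]
    · have : W k x = 0 :=
        image_eq_zero_of_notMem_tsupport fun hk => hx (Set.mem_iUnion.2 ⟨k, hk⟩)
      simp [this]
  have hfW : ∀ p k, ContDiff ℝ ∞ fun x => f p x * W k x := fun p k => (hfs p).mul (hW k)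
  have hfWc : ∀ p k, HasCompactSupport fun x => f p x * W k x := fun p k => (hWc k).mul_left
  have hpd : ∀ x, ∑ k, pd k (W k) x = ∑ p, ∑ k, pd k (fun x => f p x * W k x) x := by
    intro x
    rw [Finset.sum_comm]
    refine Finset.sum_congr rfl fun k _ => ?_
    rw [← pd_sum (fun p => hfW p k)]
    congr 1
    exact funext fun x => hsum x k
  simp_rw [hpd]
  rw [integral_finsetSum]
  · refine Finset.sum_nonneg fun p _ => hUW p _ (hfW p) (hfWc p) (fun k => ?_) ?_
    · exact (tsupport_mul_subset_left (f := fun x => f p x)).trans (hf p)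
    · intro q hq V ρ hρ
      simp_rw [mul_assoc]
      rw [← Finset.mul_sum]
      exact mul_nonneg (f.nonneg p q) (hout q hq V ρ hρ)
  · refine fun p _ => (Continuous.integrable_of_hasCompactSupport ?_ ?_).integrableOn
    · exact continuous_finsetSum _ fun k _ => (contDiff_pd (hfW p k)).continuous
    · exact HasCompactSupport.intro hKc fun x hx => Finset.sum_eq_zero fun k _ =>
        pd_zero_of_notMem_tsupport fun hk => hx (Set.mem_iUnion.2
          ⟨k, tsupport_mul_subset_right (f := fun x => f p x) hk⟩)

/-- Both `W` and `-W` are outward when `W` is tangential. -/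
theorem integral_divergence_eq_zero {Ω : Set (EuclideanSpace ℝ (Fin d))} (hΩ : IsOpen Ω)
    (hs : HasSmoothBoundary Ω) {W : Fin d → EuclideanSpace ℝ (Fin d) → ℝ}
    (hW : ∀ k, ContDiff ℝ ∞ (W k)) (hWc : ∀ k, HasCompactSupport (W k))
    (htan : ∀ p ∈ frontier Ω, ∀ V ρ, IsLocalDefiningFunction Ω p V ρ →
      ∑ k, W k p * pd k ρ p = 0) :
    ∫ x in Ω, ∑ k, pd k (W k) x = 0 := by
  have h1 := integral_divergence_nonneg hΩ hs hW hWc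
    fun p hp V ρ hρ => (htan p hp V ρ hρ).ge
  have h2 := integral_divergence_nonneg hΩ hs (W := fun k x => -W k x) (fun k => (hW k).neg)
    (fun k => (hWc k).neg) fun p hp V ρ hρ => by simp [htan p hp V ρ hρ]
  have h3 : ∀ k x, pd k (fun x => -W k x) x = -pd k (W k) x := fun k x => by
    simp [pd, fderiv_fun_neg]
  simp_rw [h3, Finset.sum_neg_distrib, integral_neg] at h2
  linarith

end Divergence

/-! ### Convexity and the sign of the boundary term. -/

section Convex

variable {d : ℕ}

/-- A convex domain has a nonnegative second fundamental form. -/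
theorem IsLocalDefiningFunction.hessian_nonneg {Ω V : Set (EuclideanSpace ℝ (Fin d))}
    {p : EuclideanSpace ℝ (Fin d)} {ρ : EuclideanSpace ℝ (Fin d) → ℝ}
    (h : IsLocalDefiningFunction Ω p V ρ) (hΩ : IsOpen Ω) (hconv : Convex ℝ Ω)
    (hp : p ∈ frontier Ω) {v : Fin d → ℝ} (hv : ∑ k, v k * pd k ρ p = 0) :
    0 ≤ ∑ l, ∑ k, v l * v k * pd l (pd k ρ) p := by
  have hρp : ρ p = 0 := h.eq_zero_of_mem_frontier hΩ h.mem hp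
  set e : EuclideanSpace ℝ (Fin d) := WithLp.toLp 2 v with he
  have hline : ∀ t, HasDerivAt (fun t : ℝ => p + t • e) e t := fun t => by
    simpa using ((hasDerivAt_id t).smul_const e).const_add p
  have hder : ∀ f : EuclideanSpace ℝ (Fin d) → ℝ, ContDiff ℝ ∞ f → ∀ t,
      HasDerivAt (fun t : ℝ => f (p + t • e)) (∑ k, v k * pd k f (p + t • e)) t := by
    intro f hf t
    have := (differentiableAt_of_contDiff_infty hf _).hasFDerivAt.comp_hasDerivAt t (hline t)
    rw [fderiv_apply_eq_sum_pd] at this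
    exact this
  have hder2 : ∀ t, HasDerivAt (fun t : ℝ => ∑ k, v k * pd k ρ (p + t • e))
      (∑ l, ∑ k, v l * v k * pd l (pd k ρ) (p + t • e)) t := by
    intro t
    have : HasDerivAt (fun t : ℝ => ∑ k, v k * pd k ρ (p + t • e))
        (∑ k, v k * ∑ l, v l * pd l (pd k ρ) (p + t • e)) t :=
      HasDerivAt.fun_sum fun k _ => (hder _ (contDiff_pd h.contDiff) t).const_mul (v k)
    convert this using 1
    rw [Finset.sum_comm]
    refine Finset.sum_congr rfl fun k _ => ?_
    rw [Finset.mul_sum]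
    exact Finset.sum_congr rfl fun l _ => by ring
  by_contra! hneg
  set H := ∑ l, ∑ k, v l * v k * pd l (pd k ρ) p with hH
  -- Suppose the Hessian value `H` is negative. Subtracting only half of the quadratic Taylor term
  -- leaves `s''(0) = H/2 < 0`, so `s ≤ 0` near `0` and `ρ (p + t e) ≤ H t²/4 < 0` for small `t ≠
  -- 0`.
  set s : ℝ → ℝ := fun t => ρ (p + t • e) - H / 4 * t ^ 2 with hs
  have hs1 : ∀ t, HasDerivAt s (∑ k, v k * pd k ρ (p + t • e) - H / 2 * t) t := by
    intro t
    have h1 : HasDerivAt s _ t :=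
      (hder ρ h.contDiff t).sub ((hasDerivAt_pow 2 t).const_mul (H / 4))
    refine h1.congr_deriv ?_
    norm_num
    ring
  have hs1' : deriv s = fun t => ∑ k, v k * pd k ρ (p + t • e) - H / 2 * t :=
    funext fun t => (hs1 t).deriv
  have hs2 : deriv (deriv s) 0 = H / 2 := by
    rw [hs1']
    have h2 : HasDerivAt (fun t => ∑ k, v k * pd k ρ (p + t • e) - H / 2 * t) _ 0 :=
      (hder2 0).sub ((hasDerivAt_id (0 : ℝ)).const_mul (H / 2))
    rw [h2.deriv]
    simp only [zero_smul, add_zero, mul_one]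
    rw [← hH]
    ring
  have hmax : IsLocalMax s 0 :=
    isLocalMax_of_deriv_deriv_neg (by rw [hs2]; linarith) (by rw [hs1']; simp [hv])
      (hs1 0).continuousAt
  have hs0 : s 0 = 0 := by simp [hs, hρp]
  have hneg2 : ∀ᶠ t in 𝓝 (0 : ℝ), t ≠ 0 → p + t • e ∈ Ω := by
    have hV : ∀ᶠ t in 𝓝 (0 : ℝ), p + t • e ∈ V := by
      have hc : ContinuousAt (fun t : ℝ => p + t • e) 0 := (hline 0).continuousAt
      exact hc.eventually (by simpa using h.isOpen.eventually_mem h.mem)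
    filter_upwards [hmax, hV] with t ht htV ht0
    rw [h.mem_iff _ htV]
    rw [hs0] at ht
    have : 0 < t ^ 2 := by positivity
    have h5 : ρ (p + t • e) ≤ H / 4 * t ^ 2 := by
      simpa [hs] using ht
    nlinarith
  obtain ⟨ε, hε, hball⟩ := Metric.eventually_nhds_iff_ball.1 hneg2
  -- Two points of `Ω` symmetric about `p` put their midpoint `p` in `Ω` by convexity, but `p` is a
  -- boundary point of an open set.
  have hm1 := hball (ε / 2) (by simp [abs_of_pos hε]; linarith) (by positivity)
  have hm2 := hball (-(ε / 2)) (by simp [abs_of_pos hε]; linarith) (by linarith)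
  have hmid := hconv hm1 hm2 (a := 1 / 2) (b := 1 / 2) (by norm_num) (by norm_num) (by norm_num)
  have heq : (1 / 2 : ℝ) • (p + (ε / 2) • e) + (1 / 2 : ℝ) • (p + (-(ε / 2)) • e) = p := by
    module
  rw [heq] at hmid
  rw [hΩ.frontier_eq] at hp
  exact hp.2 hmid

/-- The derivative of a function vanishing on the boundary vanishes in tangential directions. -/
theorem IsLocalDefiningFunction.tangential_deriv_eq_zero {Ω V : Set (EuclideanSpace ℝ (Fin d))}
    {p : EuclideanSpace ℝ (Fin d)} {ρ f : EuclideanSpace ℝ (Fin d) → ℝ}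
    (h : IsLocalDefiningFunction Ω p V ρ) (hΩ : IsOpen Ω)
    (hp : p ∈ frontier Ω) (hf : ContDiff ℝ ∞ f) (hf0 : ∀ q ∈ frontier Ω, q ∈ V → f q = 0)
    {v : Fin d → ℝ} (hv : ∑ k, v k * pd k ρ p = 0) : ∑ k, v k * pd k f p = 0 := by
  have hρp : ρ p = 0 := h.eq_zero_of_mem_frontier hΩ h.mem hp
  -- `f` is constant on `{ρ = 0}` near `p`, so `p` is a constrained extremum and Lagrange
  -- multipliers make `∇f` parallel to `∇ρ`.
  have hext : IsLocalExtrOn f {x | ρ x = ρ p} p := by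
    left
    filter_upwards [self_mem_nhdsWithin, nhdsWithin_le_nhds (h.isOpen.eventually_mem h.mem)]
      with x hx hxV
    rw [hf0 p hp h.mem, hf0 x (h.mem_frontier hxV (hx.trans hρp)) hxV]
  obtain ⟨a, b, hab, heq⟩ := hext.exists_multipliers_of_hasStrictFDerivAt_1d
    (h.contDiff.contDiffAt.hasStrictFDerivAt (by simp))
    (hf.contDiffAt.hasStrictFDerivAt (by simp))
  have hpd : ∀ k, a * pd k ρ p + b * pd k f p = 0 := fun k => by
    simpa [pd] using congrArg (fun T => T (EuclideanSpace.single k (1 : ℝ))) heq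
  have hb : b ≠ 0 := by
    rintro rfl
    have ha : a ≠ 0 := fun ha => hab (by simp [ha])
    refine h.gradient_ne_zero p h.mem ?_
    ext k
    have := hpd k
    rw [gradient_apply_eq_pd]
    simpa [ha] using this
  have h2 : a * ∑ k, v k * pd k ρ p + b * ∑ k, v k * pd k f p = 0 := by
    rw [Finset.mul_sum, Finset.mul_sum, ← Finset.sum_add_distrib]
    refine Finset.sum_eq_zero fun k _ => ?_
    linear_combination v k * hpd k
  rw [hv, mul_zero, zero_add] at h2
  exact (mul_eq_zero.1 h2).resolve_left hb

/-- On a convex domain, a field tangential to the boundary satisfies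
`∫ ∂_k v_l ∂_l v_k ≤ ∫ (div v)²`. -/
theorem integral_contraction_le_integral_divergence_sq {Ω : Set (EuclideanSpace ℝ (Fin d))}
    (hΩ : IsOpen Ω) (hs : HasSmoothBoundary Ω) (hconv : Convex ℝ Ω)
    {v : Fin d → EuclideanSpace ℝ (Fin d) → ℝ}
    (hv : ∀ k, ContDiff ℝ ∞ (v k)) (hvc : ∀ k, HasCompactSupport (v k))
    (htan : ∀ p ∈ frontier Ω, ∀ V ρ, IsLocalDefiningFunction Ω p V ρ →
      ∑ k, v k p * pd k ρ p = 0) :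
    0 ≤ ∫ x in Ω, ((∑ k, pd k (v k) x) ^ 2 - ∑ k, ∑ l, pd k (v l) x * pd l (v k) x) := by
  set D : EuclideanSpace ℝ (Fin d) → ℝ := fun x => ∑ k, pd k (v k) x with hD
  have hDs : ContDiff ℝ ∞ D := ContDiff.sum fun k _ => contDiff_pd (hv k)
  set A : Fin d → EuclideanSpace ℝ (Fin d) → ℝ := fun k x => ∑ l, v l x * pd l (v k) x with hA
  have hAs : ∀ k, ContDiff ℝ ∞ (A k) := fun k =>
    ContDiff.sum fun l _ => (hv l).mul (contDiff_pd (hv k))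
  -- `W = v div v - (v·∇)v`; the second derivatives of `v` cancel in its divergence, leaving the
  -- integrand.
  set W : Fin d → EuclideanSpace ℝ (Fin d) → ℝ := fun k x => v k x * D x - A k x with hW
  have hdiv : ∀ x, ∑ k, pd k (W k) x =
      (∑ k, pd k (v k) x) ^ 2 - ∑ k, ∑ l, pd k (v l) x * pd l (v k) x := by
    intro x
    have e1 : ∀ k, pd k (W k) x = pd k (v k) x * D x + v k x * pd k D x -
        ∑ l, (pd k (v l) x * pd l (v k) x + v l x * pd l (pd k (v k)) x) := by
      intro k
      rw [hW, pd_sub ((hv k).mul hDs) (hAs k), pd_mul (hv k) hDs, hA,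
        pd_sum fun l => (hv l).mul (contDiff_pd (hv k))]
      congr 1
      refine Finset.sum_congr rfl fun l _ => ?_
      rw [pd_mul (hv l) (contDiff_pd (hv k)), pd_comm (hv k)]
    have e2 : ∀ k, pd k D x = ∑ l, pd k (pd l (v l)) x := fun k =>
      pd_sum (fun l => contDiff_pd (hv l)) x
    simp_rw [e1, e2, Finset.sum_sub_distrib, Finset.sum_add_distrib, ← Finset.sum_mul,
      Finset.mul_sum]
    rw [Finset.sum_comm (f := fun k l => v l x * pd l (pd k (v k)) x)]
    simp only [hD]
    ring
  simp_rw [← hdiv]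
  refine integral_divergence_nonneg hΩ hs (fun k => ((hv k).mul hDs).sub (hAs k)) (fun k => ?_) ?_
  · refine HasCompactSupport.sub (hvc k).mul_right ?_
    refine HasCompactSupport.intro (isCompact_iUnion hvc) fun x hx =>
      Finset.sum_eq_zero fun l _ => ?_
    rw [image_eq_zero_of_notMem_tsupport fun hl => hx (Set.mem_iUnion.2 ⟨l, hl⟩), zero_mul]
  · intro p hp V ρ h
    have ht := htan p hp V ρ h
    have hhess := h.hessian_nonneg hΩ hconv hp ht
    -- Since `f = v·∇ρ` vanishes on `∂Ω` and `v` is tangential, `v·∇f = 0` there. Expanding it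
    -- converts the flux `-((v·∇)v)·∇ρ` of `W` into the Hessian of `ρ` at `(v, v)`, which is
    -- nonnegative by convexity.
    set f : EuclideanSpace ℝ (Fin d) → ℝ := fun x => ∑ k, v k x * pd k ρ x with hf
    have hfs : ContDiff ℝ ∞ f := ContDiff.sum fun k _ => (hv k).mul (contDiff_pd h.contDiff)
    have hder := h.tangential_deriv_eq_zero hΩ hp hfs
      (fun q hq hqV => htan q hq V ρ (h.of_mem hqV)) ht
    have e3 : ∀ l, pd l f p =
        ∑ k, (pd l (v k) p * pd k ρ p + v k p * pd l (pd k ρ) p) := by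
      intro l
      rw [hf, pd_sum fun k => (hv k).mul (contDiff_pd h.contDiff)]
      exact Finset.sum_congr rfl fun k _ => pd_mul (hv k) (contDiff_pd h.contDiff) p
    have e4 : ∑ k, W k p * pd k ρ p =
        D p * ∑ k, v k p * pd k ρ p - ∑ k, A k p * pd k ρ p := by
      rw [Finset.mul_sum, ← Finset.sum_sub_distrib]
      exact Finset.sum_congr rfl fun k _ => by simp only [hW]; ring
    have e5 : ∑ l, v l p * pd l f p = ∑ k, A k p * pd k ρ p +
        ∑ l, ∑ k, v l p * v k p * pd l (pd k ρ) p := by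
      simp_rw [e3, Finset.sum_add_distrib, mul_add, Finset.sum_add_distrib, hA, Finset.sum_mul,
        Finset.mul_sum]
      rw [Finset.sum_comm]
      simp_rw [mul_assoc]
    rw [e4, ht]
    linarith

end Convex

/-! ### Passage from real to complex fields. -/

section ComplexFields

variable {d : ℕ}

theorem re_mul_conj (z w : ℂ) : (z * (starRingEnd ℂ) w).re = z.re * w.re + z.im * w.im := by
  simp

theorem norm_sq_eq_re_sq_add_im_sq (z : ℂ) : ‖z‖ ^ 2 = z.re ^ 2 + z.im ^ 2 := by
  rw [Complex.sq_norm, Complex.normSq_apply]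
  ring

theorem hasCompactSupport_re {f : EuclideanSpace ℝ (Fin d) → ℂ} (hf : HasCompactSupport f) :
    HasCompactSupport fun x => (f x).re :=
  hf.comp_left (g := Complex.re) rfl

theorem hasCompactSupport_im {f : EuclideanSpace ℝ (Fin d) → ℂ} (hf : HasCompactSupport f) :
    HasCompactSupport fun x => (f x).im :=
  hf.comp_left (g := Complex.im) rfl

theorem contDiff_re {f : EuclideanSpace ℝ (Fin d) → ℂ} (hf : ContDiff ℝ ∞ f) :
    ContDiff ℝ ∞ fun x => (f x).re :=
  Complex.reCLM.contDiff.comp hf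

theorem contDiff_im {f : EuclideanSpace ℝ (Fin d) → ℂ} (hf : ContDiff ℝ ∞ f) :
    ContDiff ℝ ∞ fun x => (f x).im :=
  Complex.imCLM.contDiff.comp hf

theorem contDiff_conj {f : EuclideanSpace ℝ (Fin d) → ℂ} (hf : ContDiff ℝ ∞ f) :
    ContDiff ℝ ∞ fun x => (starRingEnd ℂ) (f x) :=
  (Complex.conjCLE : ℂ →L[ℝ] ℂ).contDiff.comp hf

theorem contDiff_ofReal {f : EuclideanSpace ℝ (Fin d) → ℝ} (hf : ContDiff ℝ ∞ f) :
    ContDiff ℝ ∞ fun x => (f x : ℂ) :=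
  Complex.ofRealCLM.contDiff.comp hf

theorem integrable_contraction {v : Fin d → EuclideanSpace ℝ (Fin d) → ℝ}
    (hv : ∀ k, ContDiff ℝ ∞ (v k)) (hvc : ∀ k, HasCompactSupport (v k)) :
    Integrable fun x => (∑ k, pd k (v k) x) ^ 2 - ∑ k, ∑ l, pd k (v l) x * pd l (v k) x := by
  have hc : ∀ k l, Continuous (pd k (v l)) := fun k l => (contDiff_pd (hv l)).continuous
  refine Continuous.integrable_of_hasCompactSupport (by fun_prop) ?_
  refine HasCompactSupport.intro (isCompact_iUnion hvc) fun x hx => ?_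
  have : ∀ k l, pd k (v l) x = 0 := fun k l =>
    pd_zero_of_notMem_tsupport fun h => hx (Set.mem_iUnion.2 ⟨l, h⟩)
  simp [this]

/-- The conjugated form does not mix real and imaginary parts, and both parts of a tangential field
are tangential because `∇ρ` is real. -/
theorem contraction_complex_eq {v : Fin d → EuclideanSpace ℝ (Fin d) → ℂ}
    (hv : ∀ k, ContDiff ℝ ∞ (v k)) (x : EuclideanSpace ℝ (Fin d)) :
    ‖∑ k, pd k (v k) x‖ ^ 2 -
        (∑ k, ∑ l, pd k (v l) x * (starRingEnd ℂ) (pd l (v k) x)).re =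
      ((∑ k, pd k (fun y => (v k y).re) x) ^ 2 -
        ∑ k, ∑ l, pd k (fun y => (v l y).re) x * pd l (fun y => (v k y).re) x) +
      ((∑ k, pd k (fun y => (v k y).im) x) ^ 2 -
        ∑ k, ∑ l, pd k (fun y => (v l y).im) x * pd l (fun y => (v k y).im) x) := by
  have h1 : ∀ k l, pd k (fun y => (v l y).re) x = (pd k (v l) x).re := fun k l => pd_re (hv l) x
  have h2 : ∀ k l, pd k (fun y => (v l y).im) x = (pd k (v l) x).im := fun k l => pd_im (hv l) x
  simp only [h1, h2, norm_sq_eq_re_sq_add_im_sq, Complex.re_sum, Complex.im_sum, re_mul_conj,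
    Finset.sum_add_distrib]
  ring

theorem integrable_contraction_complex {v : Fin d → EuclideanSpace ℝ (Fin d) → ℂ}
    (hv : ∀ k, ContDiff ℝ ∞ (v k)) (hvc : ∀ k, HasCompactSupport (v k)) :
    Integrable fun x => ‖∑ k, pd k (v k) x‖ ^ 2 -
      (∑ k, ∑ l, pd k (v l) x * (starRingEnd ℂ) (pd l (v k) x)).re := by
  simp_rw [contraction_complex_eq hv]
  exact (integrable_contraction (fun k => contDiff_re (hv k))
    fun k => hasCompactSupport_re (hvc k)).add (integrable_contraction
      (fun k => contDiff_im (hv k)) fun k => hasCompactSupport_im (hvc k))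

theorem integral_contraction_complex_nonneg {Ω : Set (EuclideanSpace ℝ (Fin d))}
    (hΩ : IsOpen Ω) (hs : HasSmoothBoundary Ω) (hconv : Convex ℝ Ω)
    {v : Fin d → EuclideanSpace ℝ (Fin d) → ℂ}
    (hv : ∀ k, ContDiff ℝ ∞ (v k)) (hvc : ∀ k, HasCompactSupport (v k))
    (htan : ∀ p ∈ frontier Ω, ∀ V ρ, IsLocalDefiningFunction Ω p V ρ →
      ∑ k, v k p * ((pd k ρ p : ℝ) : ℂ) = 0) :
    0 ≤ ∫ x in Ω, (‖∑ k, pd k (v k) x‖ ^ 2 -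
      (∑ k, ∑ l, pd k (v l) x * (starRingEnd ℂ) (pd l (v k) x)).re) := by
  simp_rw [contraction_complex_eq hv]
  rw [integral_add]
  · refine add_nonneg ?_ ?_
    · refine integral_contraction_le_integral_divergence_sq hΩ hs hconv
        (fun k => contDiff_re (hv k)) (fun k => hasCompactSupport_re (hvc k)) ?_
      intro p hp V ρ h
      simpa using congrArg Complex.re (htan p hp V ρ h)
    · refine integral_contraction_le_integral_divergence_sq hΩ hs hconv
        (fun k => contDiff_im (hv k)) (fun k => hasCompactSupport_im (hvc k)) ?_
      intro p hp V ρ h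
      simpa using congrArg Complex.im (htan p hp V ρ h)
  · exact (integrable_contraction (fun k => contDiff_re (hv k))
      fun k => hasCompactSupport_re (hvc k)).integrableOn
  · exact (integrable_contraction (fun k => contDiff_im (hv k))
      fun k => hasCompactSupport_im (hvc k)).integrableOn

end ComplexFields

/-! ### Pointwise algebra: coercivity of the contraction and of the energy. -/

section Algebra

variable {d : ℕ}

/-- The matrix `∂_k T_il` for the stress tensor `T`, in terms of the second derivatives `H` of the
velocity and the gradient `P` of the pressure. -/
def stressDeriv (μ : ℝ) (H : Fin d → Fin d → Fin d → ℂ) (P : Fin d → ℂ) (i k l : Fin d) : ℂ :=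
  H i k l + μ * H l k i - if i = l then P k else 0

theorem re_mul_conj_comm (z w : ℂ) :
    (z * (starRingEnd ℂ) w).re = (w * (starRingEnd ℂ) z).re := by
  rw [re_mul_conj, re_mul_conj]
  ring

theorem abs_two_re_mul_conj_le (z w : ℂ) :
    |2 * (z * (starRingEnd ℂ) w).re| ≤ ‖z‖ ^ 2 + ‖w‖ ^ 2 := by
  rw [re_mul_conj, norm_sq_eq_re_sq_add_im_sq, norm_sq_eq_re_sq_add_im_sq, abs_le]
  constructor <;> nlinarith [sq_nonneg (z.re + w.re), sq_nonneg (z.im + w.im),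
    sq_nonneg (z.re - w.re), sq_nonneg (z.im - w.im)]

/-- Here `H i k l = ∂_k ∂_l u_i`, `P = ∇φ` and `z = λu`. Of the nine products, three give the cross
term, and the mixed pressure products reduce to traces of `H`. The coefficient `1 - 2μ` collects
`|P|²` from the pressure square and from the two traces equal to `z + P`. -/
theorem sum_stressDeriv_contraction (μ : ℝ) {H : Fin d → Fin d → Fin d → ℂ} {P z : Fin d → ℂ}
    (hsym : ∀ i k l, H i k l = H i l k) (hdiv : ∀ k, ∑ i, H i k i = 0)
    (hlap : ∀ i, ∑ k, H i k k = z i + P i) :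
    (∑ i, ∑ k, ∑ l, stressDeriv μ H P i k l * (starRingEnd ℂ) (stressDeriv μ H P i l k)).re =
      ∑ i, ∑ k, ∑ l, ‖H i k l‖ ^ 2 +
      (2 * μ + μ ^ 2) * ∑ i, ∑ k, ∑ l, (H i k l * (starRingEnd ℂ) (H k i l)).re +
      (1 - 2 * μ) * ∑ k, ‖P k‖ ^ 2 -
      2 * μ * ∑ k, (z k * (starRingEnd ℂ) (P k)).re := by
  set X : ℂ := ∑ i, ∑ k, ∑ l, H i k l * (starRingEnd ℂ) (H k i l) with hX
  have hXre : X.re = ∑ i, ∑ k, ∑ l, (H i k l * (starRingEnd ℂ) (H k i l)).re := by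
    simp_rw [hX, Complex.re_sum]
  have s1 : ∑ i, ∑ k, ∑ l, H i k l * (starRingEnd ℂ) (H i k l) =
      ((∑ i, ∑ k, ∑ l, ‖H i k l‖ ^ 2 : ℝ) : ℂ) := by
    simp [Complex.mul_conj']
  -- Symmetry in the two derivative indices and relabelling identify `s2`, `s4` and `s5` with the
  -- same cross term.
  have s2 : ∑ i, ∑ k, ∑ l, H i k l * (starRingEnd ℂ) (H k l i) = X := by
    rw [hX]
    refine Finset.sum_congr rfl fun i _ => Finset.sum_congr rfl fun k _ =>
      Finset.sum_congr rfl fun l _ => ?_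
    rw [hsym k i l]
  have s4 : ∑ i, ∑ k, ∑ l, H l k i * (starRingEnd ℂ) (H i k l) = X := by
    rw [hX]
    calc _ = ∑ i, ∑ l, ∑ k, H l k i * (starRingEnd ℂ) (H i k l) :=
          Finset.sum_congr rfl fun i _ => Finset.sum_comm
      _ = ∑ l, ∑ i, ∑ k, H l k i * (starRingEnd ℂ) (H i k l) := Finset.sum_comm
      _ = _ := Finset.sum_congr rfl fun i _ => Finset.sum_congr rfl fun k _ =>
          Finset.sum_congr rfl fun l _ => by rw [hsym i l k, hsym k l i]
  have s5 : ∑ i, ∑ k, ∑ l, H l k i * (starRingEnd ℂ) (H k l i) = X := by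
    rw [hX]
    calc _ = ∑ k, ∑ i, ∑ l, H l k i * (starRingEnd ℂ) (H k l i) := Finset.sum_comm
      _ = ∑ k, ∑ l, ∑ i, H l k i * (starRingEnd ℂ) (H k l i) :=
          Finset.sum_congr rfl fun i _ => Finset.sum_comm
      _ = _ := Finset.sum_comm
  -- A Kronecker delta contracts `H` either to a derivative of the divergence, which is zero, or to
  -- the Laplacian `z + P`.
  have s3 : ∑ i, ∑ k, ∑ l, H i k l * (starRingEnd ℂ) (if i = k then P l else 0) = 0 := by
    have e : ∀ i, ∑ k, ∑ l, H i k l * (starRingEnd ℂ) (if i = k then P l else 0) =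
        ∑ l, H i l i * (starRingEnd ℂ) (P l) := fun i => by
      rw [Finset.sum_eq_single i (fun k _ hk => by simp [hk.symm]) (by simp)]
      simp [hsym i i]
    simp_rw [e]
    rw [Finset.sum_comm]
    simp_rw [← Finset.sum_mul, hdiv, zero_mul, Finset.sum_const_zero]
  have s6 : ∑ i, ∑ k, ∑ l, H l k i * (starRingEnd ℂ) (if i = k then P l else 0) =
      ∑ l, (z l + P l) * (starRingEnd ℂ) (P l) := by
    have e : ∀ i, ∑ k, ∑ l, H l k i * (starRingEnd ℂ) (if i = k then P l else 0) =
        ∑ l, H l i i * (starRingEnd ℂ) (P l) := fun i => by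
      rw [Finset.sum_eq_single i (fun k _ hk => by simp [hk.symm]) (by simp)]
      simp
    simp_rw [e]
    rw [Finset.sum_comm]
    simp_rw [← Finset.sum_mul, hlap]
  have e7 : ∀ (Q : Fin d → Fin d → Fin d → ℂ) (i k : Fin d),
      ∑ l, (if i = l then P k else 0) * Q i k l = P k * Q i k i := fun Q i k => by
    rw [Finset.sum_eq_single i (fun l _ hl => by simp [hl.symm]) (by simp)]
    simp
  have s7 : ∑ i, ∑ k, ∑ l, (if i = l then P k else 0) * (starRingEnd ℂ) (H i k l) = 0 := by
    simp_rw [e7 fun i k l => (starRingEnd ℂ) (H i k l)]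
    rw [Finset.sum_comm]
    simp_rw [← Finset.mul_sum, ← map_sum, hdiv, map_zero, mul_zero, Finset.sum_const_zero]
  have s8 : ∑ i, ∑ k, ∑ l, (if i = l then P k else 0) * (starRingEnd ℂ) (H k l i) =
      ∑ k, P k * (starRingEnd ℂ) (z k + P k) := by
    simp_rw [e7 fun i k l => (starRingEnd ℂ) (H k l i)]
    rw [Finset.sum_comm]
    simp_rw [← Finset.mul_sum, ← map_sum, hlap]
  have s9 : ∑ i, ∑ k, ∑ l, (if i = l then P k else 0) *
      (starRingEnd ℂ) (if i = k then P l else 0) = ((∑ k, ‖P k‖ ^ 2 : ℝ) : ℂ) := by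
    simp_rw [e7 fun i k l => (starRingEnd ℂ) (if i = k then P l else 0)]
    have e : ∀ i, ∑ k, P k * (starRingEnd ℂ) (if i = k then P i else 0) = (‖P i‖ : ℂ) ^ 2 :=
      fun i => by
        rw [Finset.sum_eq_single i (fun k _ hk => by simp [hk.symm]) (by simp)]
        simp [Complex.mul_conj']
    simp_rw [e]
    simp
  have hexp : ∑ i, ∑ k, ∑ l, stressDeriv μ H P i k l *
      (starRingEnd ℂ) (stressDeriv μ H P i l k) =
      ((∑ i, ∑ k, ∑ l, ‖H i k l‖ ^ 2 : ℝ) : ℂ) + ((2 * μ + μ ^ 2 : ℝ) : ℂ) * X -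
      μ * ∑ l, (z l + P l) * (starRingEnd ℂ) (P l) -
      μ * ∑ k, P k * (starRingEnd ℂ) (z k + P k) + ((∑ k, ‖P k‖ ^ 2 : ℝ) : ℂ) := by
    have e : ∀ i k l, stressDeriv μ H P i k l * (starRingEnd ℂ) (stressDeriv μ H P i l k) =
        H i k l * (starRingEnd ℂ) (H i k l) + μ * (H i k l * (starRingEnd ℂ) (H k l i)) -
        H i k l * (starRingEnd ℂ) (if i = k then P l else 0) +
        μ * (H l k i * (starRingEnd ℂ) (H i k l)) +
        μ ^ 2 * (H l k i * (starRingEnd ℂ) (H k l i)) -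
        μ * (H l k i * (starRingEnd ℂ) (if i = k then P l else 0)) -
        (if i = l then P k else 0) * (starRingEnd ℂ) (H i k l) -
        μ * ((if i = l then P k else 0) * (starRingEnd ℂ) (H k l i)) +
        (if i = l then P k else 0) * (starRingEnd ℂ) (if i = k then P l else 0) := by
      intro i k l
      rw [stressDeriv, stressDeriv, map_sub, map_add, map_mul, Complex.conj_ofReal, hsym i l k]
      ring
    simp_rw [e, Finset.sum_add_distrib, Finset.sum_sub_distrib, Finset.sum_add_distrib,
      Finset.sum_sub_distrib, Finset.sum_add_distrib, ← Finset.mul_sum]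
    rw [s1, s2, s3, s4, s5, s6, s7, s8, s9]
    push_cast
    ring
  rw [hexp, ← hXre]
  have e8 : (∑ l, (z l + P l) * (starRingEnd ℂ) (P l)).re =
      ∑ k, (z k * (starRingEnd ℂ) (P k)).re + ∑ k, ‖P k‖ ^ 2 := by
    rw [Complex.re_sum, ← Finset.sum_add_distrib]
    refine Finset.sum_congr rfl fun k _ => ?_
    rw [re_mul_conj, re_mul_conj, norm_sq_eq_re_sq_add_im_sq, Complex.add_re, Complex.add_im]
    ring
  have e9 : (∑ k, P k * (starRingEnd ℂ) (z k + P k)).re =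
      (∑ l, (z l + P l) * (starRingEnd ℂ) (P l)).re := by
    rw [Complex.re_sum, Complex.re_sum]
    exact Finset.sum_congr rfl fun k _ => re_mul_conj_comm _ _
  rw [Complex.add_re, Complex.sub_re, Complex.sub_re, Complex.add_re, Complex.re_ofReal_mul,
    Complex.re_ofReal_mul, Complex.re_ofReal_mul, e9, e8, Complex.ofReal_re, Complex.ofReal_re]
  ring

theorem abs_sum_cross_le (H : Fin d → Fin d → Fin d → ℂ) :
    |∑ i, ∑ k, ∑ l, (H i k l * (starRingEnd ℂ) (H k i l)).re| ≤
      ∑ i, ∑ k, ∑ l, ‖H i k l‖ ^ 2 := by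
  have h1 : ∑ i, ∑ k, ∑ l, ‖H k i l‖ ^ 2 = ∑ i, ∑ k, ∑ l, ‖H i k l‖ ^ 2 := Finset.sum_comm
  have h2 : |∑ i, ∑ k, ∑ l, (H i k l * (starRingEnd ℂ) (H k i l)).re| ≤
      ∑ i, ∑ k, ∑ l, (‖H i k l‖ ^ 2 + ‖H k i l‖ ^ 2) / 2 := by
    refine (Finset.abs_sum_le_sum_abs _ _).trans (Finset.sum_le_sum fun i _ => ?_)
    refine (Finset.abs_sum_le_sum_abs _ _).trans (Finset.sum_le_sum fun k _ => ?_)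
    refine (Finset.abs_sum_le_sum_abs _ _).trans (Finset.sum_le_sum fun l _ => ?_)
    have := abs_two_re_mul_conj_le (H i k l) (H k i l)
    rw [abs_mul, abs_two] at this
    linarith
  simp_rw [← Finset.sum_div, Finset.sum_add_distrib] at h2
  rw [h1] at h2
  linarith

theorem norm_sq_add_sub_le (a b c : ℂ) :
    ‖a + b - c‖ ^ 2 ≤ 3 * (‖a‖ ^ 2 + ‖b‖ ^ 2 + ‖c‖ ^ 2) := by
  have h1 : ‖a + b - c‖ ≤ ‖a‖ + ‖b‖ + ‖c‖ :=
    (norm_sub_le _ _).trans (by gcongr; exact norm_add_le _ _)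
  have h2 : ‖a + b - c‖ ^ 2 ≤ (‖a‖ + ‖b‖ + ‖c‖) ^ 2 := by gcongr
  nlinarith [sq_nonneg (‖a‖ - ‖b‖), sq_nonneg (‖a‖ - ‖c‖), sq_nonneg (‖b‖ - ‖c‖)]

theorem sum_norm_sq_stressDeriv_le {μ : ℝ} (hμ : |μ| ≤ 1) (H : Fin d → Fin d → Fin d → ℂ)
    (P : Fin d → ℂ) :
    ∑ i, ∑ k, ∑ l, ‖stressDeriv μ H P i k l‖ ^ 2 ≤
      6 * ∑ i, ∑ k, ∑ l, ‖H i k l‖ ^ 2 + 3 * d * ∑ k, ‖P k‖ ^ 2 := by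
  have h1 : ∀ i k l, ‖stressDeriv μ H P i k l‖ ^ 2 ≤
      3 * ‖H i k l‖ ^ 2 + 3 * ‖H l k i‖ ^ 2 + if i = l then 3 * ‖P k‖ ^ 2 else 0 := by
    intro i k l
    refine (norm_sq_add_sub_le _ _ _).trans ?_
    have h2 : ‖(μ : ℂ) * H l k i‖ ^ 2 ≤ ‖H l k i‖ ^ 2 := by
      rw [norm_mul, Complex.norm_real, Real.norm_eq_abs]
      have := mul_le_of_le_one_left (norm_nonneg (H l k i)) hμ
      gcongr
    split_ifs
    · linarith
    · simp only [norm_zero]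
      linarith
  have h3 : ∑ i, ∑ k, ∑ l, ‖H l k i‖ ^ 2 = ∑ i, ∑ k, ∑ l, ‖H i k l‖ ^ 2 := by
    rw [Finset.sum_comm]
    simp_rw [Finset.sum_comm (f := fun i l => ‖H l _ i‖ ^ 2)]
    rw [Finset.sum_comm]
  refine (Finset.sum_le_sum fun i _ => Finset.sum_le_sum fun k _ =>
    Finset.sum_le_sum fun l _ => h1 i k l).trans (le_of_eq ?_)
  simp_rw [Finset.sum_add_distrib, ← Finset.mul_sum]
  rw [h3]
  simp [← Finset.mul_sum]
  ring

/-- Leibniz rule for the contraction, with the lower order terms absorbed. -/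
theorem contraction_cutoff_lower_bound (A : Fin d → Fin d → Fin d → ℂ) (T : Fin d → Fin d → ℂ)
    (η : ℝ) (N : Fin d → ℝ) {ε : ℝ} (hε : 0 < ε) :
    η ^ 2 * (∑ i, ∑ k, ∑ l, A i k l * (starRingEnd ℂ) (A i l k)).re -
        ε * η ^ 2 * ∑ i, ∑ k, ∑ l, ‖A i k l‖ ^ 2 -
        (1 / ε + 1) * ((∑ k, N k ^ 2) * ∑ i, ∑ k, ‖T i k‖ ^ 2) ≤
      (∑ i, ∑ k, ∑ l, (η * A i k l + N k * T i l) *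
        (starRingEnd ℂ) (η * A i l k + N l * T i k)).re := by
  -- Young's inequality with weight `ε` treats the mixed products and, with weight one, the product
  -- of the two lower order terms; hence `1 / ε + 1`.
  have h1 : ∀ (a a' t t' : ℂ) (n n' : ℝ),
      η ^ 2 * (a * (starRingEnd ℂ) a').re - ε / 2 * η ^ 2 * (‖a‖ ^ 2 + ‖a'‖ ^ 2) -
        (1 / ε + 1) / 2 * (n ^ 2 * ‖t‖ ^ 2 + n' ^ 2 * ‖t'‖ ^ 2) ≤
      ((η * a + n * t) * (starRingEnd ℂ) (η * a' + n' * t')).re := by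
    intro a a' t t' n n'
    have key : ∀ (x y : ℝ), -(ε / 2 * x ^ 2 + 1 / ε / 2 * y ^ 2) ≤ x * y := by
      intro x y
      have : 0 ≤ (ε * x + y) ^ 2 / (2 * ε) := by positivity
      have e : (ε * x + y) ^ 2 / (2 * ε) = ε / 2 * x ^ 2 + x * y + 1 / ε / 2 * y ^ 2 := by
        field_simp
        ring
      linarith
    rw [re_mul_conj, re_mul_conj]
    simp only [norm_sq_eq_re_sq_add_im_sq, Complex.add_re, Complex.add_im, Complex.re_ofReal_mul,
      Complex.im_ofReal_mul]
    linarith [key (η * a.re) (n' * t'.re), key (η * a.im) (n' * t'.im),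
      key (η * a'.re) (n * t.re), key (η * a'.im) (n * t.im),
      sq_nonneg (n * t.re + n' * t'.re), sq_nonneg (n * t.im + n' * t'.im)]
  have e1 : ∑ i, ∑ k, ∑ l, ‖A i l k‖ ^ 2 = ∑ i, ∑ k, ∑ l, ‖A i k l‖ ^ 2 :=
    Finset.sum_congr rfl fun i _ => Finset.sum_comm
  have e2 : ∑ i, ∑ k, ∑ l, N k ^ 2 * ‖T i l‖ ^ 2 = (∑ k, N k ^ 2) * ∑ i, ∑ k, ‖T i k‖ ^ 2 := by
    simp_rw [← Finset.mul_sum, ← Finset.sum_mul, ← Finset.mul_sum]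
  have e3 : ∑ i, ∑ k, ∑ l, N l ^ 2 * ‖T i k‖ ^ 2 = (∑ k, N k ^ 2) * ∑ i, ∑ k, ‖T i k‖ ^ 2 := by
    simp_rw [← Finset.sum_mul, ← Finset.mul_sum]
  have h2 := Finset.sum_le_sum fun i (_ : i ∈ Finset.univ) =>
    Finset.sum_le_sum fun k (_ : k ∈ Finset.univ) =>
      Finset.sum_le_sum fun l (_ : l ∈ Finset.univ) =>
        h1 (A i k l) (A i l k) (T i l) (T i k) (N k) (N l)
  simp_rw [Finset.sum_sub_distrib, ← Finset.mul_sum, Finset.sum_add_distrib] at h2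
  rw [e1, e2, e3] at h2
  simp_rw [Complex.re_sum]
  linarith

theorem norm_sq_sum_le (η : ℝ) (z : Fin d → ℂ) (T : Fin d → Fin d → ℂ) (N : Fin d → ℝ) :
    ∑ i, ‖η * z i + ∑ k, N k * T i k‖ ^ 2 ≤
      2 * η ^ 2 * ∑ i, ‖z i‖ ^ 2 + 2 * ((∑ k, N k ^ 2) * ∑ i, ∑ k, ‖T i k‖ ^ 2) := by
  have h1 : ∀ i, ‖η * z i + ∑ k, N k * T i k‖ ^ 2 ≤
      2 * η ^ 2 * ‖z i‖ ^ 2 + 2 * ((∑ k, N k ^ 2) * ∑ k, ‖T i k‖ ^ 2) := by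
    intro i
    have a1 : ‖∑ k, (N k : ℂ) * T i k‖ ≤ ∑ k, |N k| * ‖T i k‖ :=
      (norm_sum_le _ _).trans (by simp)
    have a2 : ‖∑ k, (N k : ℂ) * T i k‖ ^ 2 ≤ (∑ k, N k ^ 2) * ∑ k, ‖T i k‖ ^ 2 := by
      calc _ ≤ (∑ k, |N k| * ‖T i k‖) ^ 2 := by gcongr
        _ ≤ (∑ k, |N k| ^ 2) * ∑ k, ‖T i k‖ ^ 2 := Finset.sum_mul_sq_le_sq_mul_sq _ _ _
        _ = _ := by simp
    have a3 := norm_add_le ((η : ℂ) * z i) (∑ k, (N k : ℂ) * T i k)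
    have a4 : ‖(η : ℂ) * z i‖ ^ 2 = η ^ 2 * ‖z i‖ ^ 2 := by simp [mul_pow]
    have a5 : ‖η * z i + ∑ k, (N k : ℂ) * T i k‖ ^ 2 ≤
        (‖(η : ℂ) * z i‖ + ‖∑ k, (N k : ℂ) * T i k‖) ^ 2 := by gcongr
    nlinarith [sq_nonneg (‖(η : ℂ) * z i‖ - ‖∑ k, (N k : ℂ) * T i k‖)]
  refine (Finset.sum_le_sum fun i _ => h1 i).trans (le_of_eq ?_)
  simp_rw [Finset.sum_add_distrib, ← Finset.mul_sum]

/-- Pointwise coercivity of the localized contraction. -/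
theorem exists_pointwise_hessian_bound (d : ℕ) {μ : ℝ} (hμ : μ ∈ Set.Ioo (-1) (√2 - 1)) :
    ∃ κ C : ℝ, 0 < κ ∧ 0 < C ∧ ∀ (H : Fin d → Fin d → Fin d → ℂ) (P z : Fin d → ℂ)
      (T : Fin d → Fin d → ℂ) (η : ℝ) (N : Fin d → ℝ),
      (∀ i k l, H i k l = H i l k) → (∀ k, ∑ i, H i k i = 0) →
      (∀ i, ∑ k, H i k k = z i + P i) → η ^ 2 ≤ 1 →
      κ * (η ^ 2 * (∑ i, ∑ k, ∑ l, ‖H i k l‖ ^ 2 + ∑ k, ‖P k‖ ^ 2)) ≤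
        (∑ i, ∑ k, ∑ l, (η * stressDeriv μ H P i k l + N k * T i l) *
          (starRingEnd ℂ) (η * stressDeriv μ H P i l k + N l * T i k)).re -
        ∑ i, ‖η * z i + ∑ k, N k * T i k‖ ^ 2 +
        C * (∑ i, ‖z i‖ ^ 2 + (∑ k, N k ^ 2) * ∑ i, ∑ k, ‖T i k‖ ^ 2) := by
  have hs2 : √2 ^ 2 = 2 := Real.sq_sqrt (by norm_num)
  have hs0 := Real.sqrt_nonneg 2
  have hs15 : √2 < 3 / 2 := by nlinarith
  have hμ1 : |μ| ≤ 1 := abs_le.2 ⟨hμ.1.le, by linarith [hμ.2]⟩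
  -- This is `0 < (1 + μ)² < 2`, the place where both endpoints of the range of `μ` enter.
  have hm : |2 * μ + μ ^ 2| < 1 := by
    rw [abs_lt]
    constructor <;> nlinarith [hμ.1, hμ.2]
  set a := 1 - |2 * μ + μ ^ 2| with ha
  set b := 1 - 2 * μ with hb
  have ha0 : 0 < a := by linarith
  have hb0 : 0 < b := by linarith [hμ.2]
  -- Half of `b |P|²` is spent on the product of `z` and `P`.
  set κ := min a (b / 2) with hκ
  have hκ0 : 0 < κ := lt_min ha0 (by linarith)
  -- Chosen so that `ε` times the square of the stress derivatives, at most `(6 + 3d)(HH + PP)`,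
  -- uses up half of `κ (HH + PP)`.
  set ε := κ / 2 / (6 + 3 * d) with hε
  have hε0 : 0 < ε := by positivity
  refine ⟨κ / 2, (2 / b + 2) + (1 / ε + 3), by positivity, by positivity,
    fun H P z T η N hsym hdiv hlap hη => ?_⟩
  have h1 := contraction_cutoff_lower_bound (stressDeriv μ H P) T η N hε0
  have h2 := norm_sq_sum_le η z T N
  have h3 := sum_norm_sq_stressDeriv_le hμ1 H P
  rw [sum_stressDeriv_contraction μ hsym hdiv hlap] at h1
  have h4 := abs_sum_cross_le H
  set X := ∑ i, ∑ k, ∑ l, (H i k l * (starRingEnd ℂ) (H k i l)).re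
  set HH := ∑ i, ∑ k, ∑ l, ‖H i k l‖ ^ 2
  set PP := ∑ k, ‖P k‖ ^ 2
  set ZZ := ∑ i, ‖z i‖ ^ 2
  set NT := (∑ k, N k ^ 2) * ∑ i, ∑ k, ‖T i k‖ ^ 2
  set AA := ∑ i, ∑ k, ∑ l, ‖stressDeriv μ H P i k l‖ ^ 2
  have hHH : 0 ≤ HH := by positivity
  have hPP : 0 ≤ PP := by positivity
  have hZZ : 0 ≤ ZZ := by positivity
  have hNT : 0 ≤ NT := by positivity
  have h5 : 2 * μ * ∑ k, (z k * (starRingEnd ℂ) (P k)).re ≤ b / 2 * PP + 2 / b * ZZ := by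
    rw [Finset.mul_sum, Finset.mul_sum, Finset.mul_sum, ← Finset.sum_add_distrib]
    refine Finset.sum_le_sum fun k _ => ?_
    have h6 : |(z k * (starRingEnd ℂ) (P k)).re| ≤ ‖z k‖ * ‖P k‖ :=
      (Complex.abs_re_le_norm _).trans (by simp)
    have h7 : 2 * μ * (z k * (starRingEnd ℂ) (P k)).re ≤ 2 * (‖z k‖ * ‖P k‖) := by
      have h8 : |2 * μ * (z k * (starRingEnd ℂ) (P k)).re| ≤ 2 * 1 * (‖z k‖ * ‖P k‖) := by
        rw [abs_mul, abs_mul, abs_two]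
        gcongr
      linarith [le_abs_self (2 * μ * (z k * (starRingEnd ℂ) (P k)).re)]
    have h9 : 0 ≤ (b * ‖P k‖ - 2 * ‖z k‖) ^ 2 / (2 * b) := by positivity
    have h10 : (b * ‖P k‖ - 2 * ‖z k‖) ^ 2 / (2 * b) =
        b / 2 * ‖P k‖ ^ 2 + 2 / b * ‖z k‖ ^ 2 - 2 * (‖z k‖ * ‖P k‖) := by
      field_simp
      ring
    linarith
  have h6 : -(|2 * μ + μ ^ 2| * HH) ≤ (2 * μ + μ ^ 2) * X := by
    have : |(2 * μ + μ ^ 2) * X| ≤ |2 * μ + μ ^ 2| * HH := by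
      rw [abs_mul]
      gcongr
    linarith [neg_abs_le ((2 * μ + μ ^ 2) * X)]
  have h7 : κ * (HH + PP) ≤ a * HH + b / 2 * PP := by
    have := mul_le_mul_of_nonneg_right (min_le_left a (b / 2)) hHH
    have := mul_le_mul_of_nonneg_right (min_le_right a (b / 2)) hPP
    linarith
  have h8 : ε * AA ≤ κ / 2 * (HH + PP) := by
    have h9 : AA ≤ (6 + 3 * d) * (HH + PP) := by
      have : 0 ≤ (d : ℝ) := Nat.cast_nonneg d
      nlinarith [mul_nonneg this hHH]
    calc ε * AA ≤ ε * ((6 + 3 * d) * (HH + PP)) := by gcongr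
      _ = κ / 2 * (HH + PP) := by
        rw [hε]
        field_simp
  have h9 : κ / 2 * (HH + PP) - 2 / b * ZZ ≤
      HH + (2 * μ + μ ^ 2) * X + b * PP -
        2 * μ * ∑ k, (z k * (starRingEnd ℂ) (P k)).re - ε * AA := by
    linarith
  have h10 := mul_le_mul_of_nonneg_left h9 (sq_nonneg η)
  have h11 : η ^ 2 * ((2 / b + 2) * ZZ) ≤ (2 / b + 2) * ZZ :=
    mul_le_of_le_one_left (by positivity) hη
  have h12 : 0 ≤ (2 / b + 2) * NT := by positivity
  have h13 : 0 ≤ (1 / ε + 3) * ZZ := by positivity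
  linarith

/-- The pressure is paired with the trace of `g`, which is zero, and the transposed term costs at
most `|μ| |g|²`. -/
theorem sum_conj_mul_stress_lower_bound {μ : ℝ} {g : Fin d → Fin d → ℂ} {φ : ℂ}
    {T : Fin d → Fin d → ℂ} (hT : ∀ i k, T i k = g i k + μ * g k i - if i = k then φ else 0)
    (hdiv : ∑ i, g i i = 0) :
    (1 - |μ|) * ∑ i, ∑ k, ‖g i k‖ ^ 2 ≤ ∑ i, ∑ k, ((starRingEnd ℂ) (g i k) * T i k).re := by
  have h1 : ∀ i k, ((starRingEnd ℂ) (g i k) * T i k).re =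
      ‖g i k‖ ^ 2 + μ * (g k i * (starRingEnd ℂ) (g i k)).re -
        ((starRingEnd ℂ) (g i k) * if i = k then φ else 0).re := by
    intro i k
    rw [hT, norm_sq_eq_re_sq_add_im_sq]
    generalize (if i = k then φ else 0) = w
    simp
    ring
  have h2 : ∑ i, ∑ k, ((starRingEnd ℂ) (g i k) * if i = k then φ else 0).re = 0 := by
    have e : ∀ i, ∑ k, ((starRingEnd ℂ) (g i k) * if i = k then φ else 0).re =
        ((starRingEnd ℂ) (g i i) * φ).re := fun i => by
      rw [Finset.sum_eq_single i (fun k _ hk => by simp [hk.symm]) (by simp)]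
      simp
    simp_rw [e]
    rw [← Complex.re_sum, ← Finset.sum_mul, ← map_sum, hdiv]
    simp
  have h3 : ∑ i, ∑ k, ‖g k i‖ ^ 2 = ∑ i, ∑ k, ‖g i k‖ ^ 2 := Finset.sum_comm
  have h4 : ∑ i, ∑ k, -(|μ| * ((‖g i k‖ ^ 2 + ‖g k i‖ ^ 2) / 2)) ≤
      ∑ i, ∑ k, μ * (g k i * (starRingEnd ℂ) (g i k)).re := by
    refine Finset.sum_le_sum fun i _ => Finset.sum_le_sum fun k _ => ?_
    have h5 := abs_two_re_mul_conj_le (g k i) (g i k)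
    rw [abs_mul, abs_two] at h5
    have h6 : |μ * (g k i * (starRingEnd ℂ) (g i k)).re| ≤
        |μ| * ((‖g i k‖ ^ 2 + ‖g k i‖ ^ 2) / 2) := by
      rw [abs_mul]
      gcongr
      linarith
    exact neg_le_of_abs_le h6
  simp_rw [Finset.sum_neg_distrib, ← Finset.mul_sum, ← Finset.sum_div,
    Finset.sum_add_distrib] at h4
  rw [h3] at h4
  simp_rw [h1, Finset.sum_sub_distrib, Finset.sum_add_distrib, ← Finset.mul_sum]
  rw [h2]
  linarith

/-- Pointwise coercivity of the localized energy. -/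
theorem pointwise_gradient_bound {μ : ℝ} {L : ℝ} (hL : 0 ≤ L)
    {g : Fin d → Fin d → ℂ} {u z : Fin d → ℂ} {φ : ℂ} {η : ℝ} {N : Fin d → ℝ}
    {T : Fin d → Fin d → ℂ} (hT : ∀ i k, T i k = g i k + μ * g k i - if i = k then φ else 0)
    (hdiv : ∑ i, g i i = 0) (hη : η ^ 2 ≤ 1) (hz : ∀ i, ‖z i‖ = L * ‖u i‖) :
    L * (1 - |μ|) * (η ^ 2 * ∑ i, ∑ k, ‖g i k‖ ^ 2) ≤
      L * (∑ k, ∑ i, (2 * η * N k * ((starRingEnd ℂ) (u i) * T i k) +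
        η ^ 2 * ((starRingEnd ℂ) (g i k) * T i k)) +
          ∑ i, η ^ 2 * ((starRingEnd ℂ) (u i) * z i)).re +
      (1 + d) * ∑ i, ‖z i‖ ^ 2 + (∑ k, N k ^ 2) * ∑ i, ∑ k, ‖T i k‖ ^ 2 := by
  have hη1 : |η| ≤ 1 := (sq_le_one_iff_abs_le_one η).1 hη
  have h1 := sum_conj_mul_stress_lower_bound hT hdiv
  -- As `L |u_i| = |z_i|`, each product is bounded by `|z_i|² + N_k² |T_ik|²`; the sum over `k`
  -- produces the factor `d`.
  have h2 : -(d * ∑ i, ‖z i‖ ^ 2 + (∑ k, N k ^ 2) * ∑ i, ∑ k, ‖T i k‖ ^ 2) ≤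
      L * ∑ k, ∑ i, (2 * η * N k * ((starRingEnd ℂ) (u i) * T i k)).re := by
    have e1 : ∑ k, ∑ i, (‖z i‖ ^ 2 + (∑ k, N k ^ 2) * ‖T i k‖ ^ 2) =
        d * ∑ i, ‖z i‖ ^ 2 + (∑ k, N k ^ 2) * ∑ i, ∑ k, ‖T i k‖ ^ 2 := by
      simp_rw [Finset.sum_add_distrib, ← Finset.mul_sum]
      rw [Finset.sum_comm (f := fun k i => ‖T i k‖ ^ 2)]
      simp
    rw [← e1, ← Finset.sum_neg_distrib, Finset.mul_sum]
    refine Finset.sum_le_sum fun k _ => ?_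
    rw [← Finset.sum_neg_distrib, Finset.mul_sum]
    refine Finset.sum_le_sum fun i _ => ?_
    have hN : N k ^ 2 ≤ ∑ k, N k ^ 2 :=
      Finset.single_le_sum (f := fun k => N k ^ 2) (fun _ _ => sq_nonneg _) (Finset.mem_univ k)
    have hNT : N k ^ 2 * ‖T i k‖ ^ 2 ≤ (∑ k, N k ^ 2) * ‖T i k‖ ^ 2 := by gcongr
    have hle : ‖2 * (η : ℂ) * N k * ((starRingEnd ℂ) (u i) * T i k)‖ ≤
        2 * (‖u i‖ * (|N k| * ‖T i k‖)) := by
      simp only [norm_mul, Complex.norm_real, Real.norm_eq_abs, Complex.norm_ofNat,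
        RCLike.norm_conj]
      calc 2 * |η| * |N k| * (‖u i‖ * ‖T i k‖) ≤ 2 * 1 * |N k| * (‖u i‖ * ‖T i k‖) := by gcongr
        _ = _ := by ring
    have h3 := (Complex.abs_re_le_norm _).trans hle
    have h4 := mul_le_mul_of_nonneg_left (neg_le_of_abs_le h3) hL
    have h5 := sq_nonneg (‖z i‖ - |N k| * ‖T i k‖)
    have h6 : (‖z i‖ - |N k| * ‖T i k‖) ^ 2 =
        ‖z i‖ ^ 2 - 2 * (L * ‖u i‖ * (|N k| * ‖T i k‖)) + N k ^ 2 * ‖T i k‖ ^ 2 := by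
      rw [sub_sq, mul_pow, sq_abs, hz i]
      ring
    linarith
  have h3 : -∑ i, ‖z i‖ ^ 2 ≤ L * ∑ i, (η ^ 2 * ((starRingEnd ℂ) (u i) * z i)).re := by
    rw [← Finset.sum_neg_distrib, Finset.mul_sum]
    refine Finset.sum_le_sum fun i _ => ?_
    have hle : ‖(η : ℂ) ^ 2 * ((starRingEnd ℂ) (u i) * z i)‖ ≤ ‖u i‖ * ‖z i‖ := by
      rw [norm_mul, norm_mul, norm_pow, Complex.norm_real, Real.norm_eq_abs, sq_abs,
        RCLike.norm_conj]
      exact mul_le_of_le_one_left (by positivity) hη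
    have h4 := mul_le_mul_of_nonneg_left
      (neg_le_of_abs_le ((Complex.abs_re_le_norm _).trans hle)) hL
    have h5 : ‖z i‖ ^ 2 = L * (‖u i‖ * ‖z i‖) := by
      rw [sq]
      nth_rewrite 1 [hz i]
      ring
    linarith
  have h4 : L * (η ^ 2 * ((1 - |μ|) * ∑ i, ∑ k, ‖g i k‖ ^ 2)) ≤
      L * ∑ k, ∑ i, (η ^ 2 * ((starRingEnd ℂ) (g i k) * T i k)).re := by
    have e2 : ∑ k, ∑ i, ((η : ℂ) ^ 2 * ((starRingEnd ℂ) (g i k) * T i k)).re =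
        η ^ 2 * ∑ i, ∑ k, ((starRingEnd ℂ) (g i k) * T i k).re := by
      rw [Finset.sum_comm]
      simp_rw [Finset.mul_sum, ← Complex.ofReal_pow, Complex.re_ofReal_mul]
    rw [e2]
    gcongr
  rw [Complex.add_re]
  simp_rw [Complex.re_sum, Complex.add_re, Finset.sum_add_distrib]
  linarith

theorem sum_norm_sq_stress_le {μ : ℝ} (hμ : |μ| ≤ 1) (g : Fin d → Fin d → ℂ) (φ : ℂ) :
    ∑ i, ∑ k, ‖g i k + μ * g k i - if i = k then φ else 0‖ ^ 2 ≤
      (6 + 3 * d) * (∑ i, ∑ k, ‖g i k‖ ^ 2 + ‖φ‖ ^ 2) := by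
  have h1 : ∀ i k, ‖g i k + μ * g k i - if i = k then φ else 0‖ ^ 2 ≤
      3 * ‖g i k‖ ^ 2 + 3 * ‖g k i‖ ^ 2 + if i = k then 3 * ‖φ‖ ^ 2 else 0 := by
    intro i k
    refine (norm_sq_add_sub_le _ _ _).trans ?_
    have h2 : ‖(μ : ℂ) * g k i‖ ^ 2 ≤ ‖g k i‖ ^ 2 := by
      rw [norm_mul, Complex.norm_real, Real.norm_eq_abs]
      have := mul_le_of_le_one_left (norm_nonneg (g k i)) hμ
      gcongr
    split_ifs
    · linarith
    · simp only [norm_zero]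
      linarith
  have h3 : ∑ i, ∑ k, ‖g k i‖ ^ 2 = ∑ i, ∑ k, ‖g i k‖ ^ 2 := Finset.sum_comm
  refine (Finset.sum_le_sum fun i _ => Finset.sum_le_sum fun k _ => h1 i k).trans ?_
  simp_rw [Finset.sum_add_distrib, ← Finset.mul_sum]
  rw [h3]
  have h4 : 0 ≤ (d : ℝ) * ∑ i, ∑ k, ‖g i k‖ ^ 2 := by positivity
  have h5 : 0 ≤ ‖φ‖ ^ 2 := by positivity
  simp
  nlinarith

end Algebra

/-! ### Cubes and scaled cutoff functions. -/

section Cutoff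

variable {d : ℕ}

theorem isCompact_closedCube (c : EuclideanSpace ℝ (Fin d)) (a : ℝ) :
    IsCompact {x : EuclideanSpace ℝ (Fin d) | ∀ i, |x i - c i| ≤ a} := by
  have h1 : IsCompact (Set.univ.pi fun i => Set.Icc (c i - a) (c i + a)) :=
    isCompact_univ_pi fun i => isCompact_Icc
  have h2 := h1.image (PiLp.continuous_toLp 2 fun _ : Fin d => ℝ)
  convert h2 using 1
  ext x
  constructor
  · intro hx
    refine ⟨x.ofLp, fun i _ => ?_, rfl⟩
    have := abs_le.1 (hx i)
    exact ⟨by linarith, by linarith⟩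
  · rintro ⟨y, hy, rfl⟩ i
    have := hy i (Set.mem_univ i)
    exact abs_le.2 ⟨by linarith [this.1], by linarith [this.2]⟩

theorem isOpen_cube (c : EuclideanSpace ℝ (Fin d)) (R : ℝ) : IsOpen (cube c R) := by
  have : cube c R = ⋂ i, {x : EuclideanSpace ℝ (Fin d) | |x i - c i| < R / (2 * √(d : ℝ))} := by
    ext x
    simp [cube]
  rw [this]
  exact isOpen_iInter_of_finite fun i => isOpen_lt (by fun_prop) continuous_const

theorem integrableOn_cube {f : EuclideanSpace ℝ (Fin d) → ℝ} (hf : Continuous f)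
    (c : EuclideanSpace ℝ (Fin d)) (R : ℝ) (Ω : Set (EuclideanSpace ℝ (Fin d))) :
    IntegrableOn f (cube c R ∩ Ω) :=
  (hf.continuousOn.integrableOn_compact (isCompact_closedCube c (R / (2 * √(d : ℝ))))).mono_set
    fun _ hx i => (hx.1 i).le

/-- Smooth cutoff functions between concentric cubes, with the natural scaling of the gradient. -/
theorem exists_cutoff (hd : 0 < d) : ∃ M : ℝ, 0 < M ∧
    ∀ (c : EuclideanSpace ℝ (Fin d)) (R : ℝ), 0 < R → ∃ η : EuclideanSpace ℝ (Fin d) → ℝ,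
      ContDiff ℝ ∞ η ∧ HasCompactSupport η ∧ tsupport η ⊆ cube c (2 * R) ∧
      (∀ x ∈ cube c R, η x = 1) ∧ (∀ x, η x ^ 2 ≤ 1) ∧
      ∀ x, ∑ k, pd k η x ^ 2 ≤ M / R ^ 2 := by
  -- `a` is half the side of a cube of diameter one. A single profile, supported in the dilation by
  -- `3/2`, is rescaled for every cube, so `M` depends on `d` alone.
  set a : ℝ := 1 / (2 * √(d : ℝ)) with ha
  have ha0 : 0 < a := by positivity
  set t : Set (EuclideanSpace ℝ (Fin d)) := {x | ∀ i, |x i - (0 : EuclideanSpace ℝ (Fin d)) i|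
    ≤ 3 / 2 * a} with ht
  have htc : IsCompact t := isCompact_closedCube 0 _
  have hst : {x : EuclideanSpace ℝ (Fin d) | ∀ i, |x i - (0 : EuclideanSpace ℝ (Fin d)) i| ≤ a} ⊆
      interior t := by
    intro x hx
    refine mem_interior.2 ⟨cube 0 (3 / 2), fun y hy i => ?_, isOpen_cube _ _, fun i => ?_⟩
    · refine (hy i).le.trans (le_of_eq ?_)
      rw [ha]
      ring
    · refine (hx i).trans_lt ?_
      have : 3 / 2 / (2 * √(d : ℝ)) = 3 / 2 * a := by rw [ha]; ring
      rw [this]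
      linarith
  obtain ⟨f, hf1, hf0, hf01⟩ := exists_contMDiffMap_one_nhds_of_subset_interior (n := (⊤ : ℕ∞))
    (modelWithCornersSelf ℝ (EuclideanSpace ℝ (Fin d)))
    (isCompact_closedCube (0 : EuclideanSpace ℝ (Fin d)) a).isClosed hst
  have hfs : ContDiff ℝ ∞ f := f.contMDiff.contDiff
  have hfc : HasCompactSupport f := HasCompactSupport.intro htc hf0
  have hNc : Continuous fun x => ∑ k, pd k f x ^ 2 :=
    continuous_finsetSum _ fun k _ => (contDiff_pd hfs).continuous.pow 2
  have hNs : HasCompactSupport fun x => ∑ k, pd k f x ^ 2 :=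
    HasCompactSupport.intro hfc fun x hx => Finset.sum_eq_zero fun k _ => by
      rw [pd_zero_of_notMem_tsupport hx]
      simp
  obtain ⟨M, hM⟩ := hNs.exists_bound_of_continuous hNc
  refine ⟨max M 1, by positivity, fun c R hR => ?_⟩
  have hsc : ∀ x i, |x i - c i| = R * |(R⁻¹ • (x - c)) i -
      (0 : EuclideanSpace ℝ (Fin d)) i| := by
    intro x i
    simp only [PiLp.smul_apply, PiLp.sub_apply, PiLp.zero_apply, sub_zero, smul_eq_mul, abs_mul,
      abs_inv, abs_of_pos hR]
    field_simp
  have hsupp : ∀ x, x ∉ {x : EuclideanSpace ℝ (Fin d) | ∀ i, |x i - c i| ≤ R * (3 / 2 * a)} →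
      f (R⁻¹ • (x - c)) = 0 := by
    intro x hx
    refine hf0 _ fun hxt => hx fun i => ?_
    rw [hsc]
    exact mul_le_mul_of_nonneg_left (hxt i) hR.le
  refine ⟨fun x => f (R⁻¹ • (x - c)), hfs.comp (by fun_prop),
    HasCompactSupport.intro (isCompact_closedCube c _) hsupp, ?_, fun x hx => ?_, fun x => ?_,
    fun x => ?_⟩
  · have h1 : tsupport (fun x => f (R⁻¹ • (x - c))) ⊆
        {x : EuclideanSpace ℝ (Fin d) | ∀ i, |x i - c i| ≤ R * (3 / 2 * a)} :=
      closure_minimal (fun x hx => by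
        by_contra h
        exact hx (hsupp x h)) (isCompact_closedCube c _).isClosed
    refine h1.trans fun x hx i => (hx i).trans_lt ?_
    have : 2 * R / (2 * √(d : ℝ)) = R * (2 * a) := by rw [ha]; ring
    rw [this]
    exact mul_lt_mul_of_pos_left (by linarith) hR
  · refine hf1.self_of_nhdsSet _ fun i => ?_
    have h2 := (hx i).le
    rw [hsc] at h2
    have : R / (2 * √(d : ℝ)) = R * a := by rw [ha]; ring
    rw [this] at h2
    exact le_of_mul_le_mul_left h2 hR
  · have := hf01 (R⁻¹ • (x - c))
    exact pow_le_one₀ this.1 this.2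
  · have h3 : ∀ k, pd k (fun x => f (R⁻¹ • (x - c))) x = R⁻¹ * pd k f (R⁻¹ • (x - c)) := by
      intro k
      have h4 : HasFDerivAt (fun x : EuclideanSpace ℝ (Fin d) => R⁻¹ • (x - c))
          (R⁻¹ • ContinuousLinearMap.id ℝ _) x :=
        ((hasFDerivAt_id x).sub_const c).const_smul R⁻¹
      have h5 := ((differentiableAt_of_contDiff_infty hfs (R⁻¹ • (x - c))).hasFDerivAt.comp x
        h4).fderiv
      change fderiv ℝ (f ∘ fun x => R⁻¹ • (x - c)) x _ = _
      rw [h5]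
      simp [pd]
    simp_rw [h3, mul_pow, ← Finset.mul_sum]
    have h6 := (le_abs_self _).trans ((hM (R⁻¹ • (x - c))).trans (le_max_left M 1))
    rw [div_eq_inv_mul, inv_pow]
    exact mul_le_mul_of_nonneg_left h6 (by positivity)

end Cutoff

/-! ### Derivatives of the stress tensor and of its localizations. -/

section Stress

variable {d : ℕ}

/-- The stress tensor `Du + μ [Du]ᵀ - φ I`. -/
noncomputable def stress (μ : ℝ) (U : Fin d → EuclideanSpace ℝ (Fin d) → ℂ) (φ : EuclideanSpace ℝ (Fin d) → ℂ)
    (i k : Fin d) (x : EuclideanSpace ℝ (Fin d)) : ℂ :=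
  pd k (U i) x + μ * pd i (U k) x - if i = k then φ x else 0

variable {μ : ℝ} {U : Fin d → EuclideanSpace ℝ (Fin d) → ℂ} {φ : EuclideanSpace ℝ (Fin d) → ℂ}

theorem contDiff_ite_zero (hφ : ContDiff ℝ ∞ φ) (p : Prop) [Decidable p] :
    ContDiff ℝ ∞ fun x => if p then φ x else 0 := by
  split_ifs
  · exact hφ
  · exact contDiff_const

theorem contDiff_stress (hU : ∀ i, ContDiff ℝ ∞ (U i)) (hφ : ContDiff ℝ ∞ φ) (i k : Fin d) :
    ContDiff ℝ ∞ (stress μ U φ i k) :=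
  ((contDiff_pd (hU i)).add (contDiff_const.mul (contDiff_pd (hU k)))).sub
    (contDiff_ite_zero hφ _)

theorem pd_stress (hU : ∀ i, ContDiff ℝ ∞ (U i)) (hφ : ContDiff ℝ ∞ φ) (i k l : Fin d)
    (x : EuclideanSpace ℝ (Fin d)) :
    pd k (stress μ U φ i l) x =
      stressDeriv μ (fun i k l => pd k (pd l (U i)) x) (fun k => pd k φ x) i k l := by
  have h1 : pd k (fun x => if i = l then φ x else 0) x = if i = l then pd k φ x else 0 := by
    split_ifs <;> simp
  have h2 : stress μ U φ i l = fun y => (fun y => pd l (U i) y + μ * pd i (U l) y) y -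
    (fun y => if i = l then φ y else 0) y := rfl
  rw [h2, pd_sub ((contDiff_pd (hU i)).add (contDiff_const.mul (contDiff_pd (hU l))))
    (contDiff_ite_zero hφ _), pd_add (contDiff_pd (hU i)) (contDiff_const.mul
    (contDiff_pd (hU l))), pd_mul contDiff_const (contDiff_pd (hU l)), h1]
  simp [stressDeriv]

/-- The divergence of row `i` of the stress is `Δu_i + μ ∂_i div u - ∂_i φ`, and the middle term
vanishes. -/
theorem sum_stressDeriv_diag {H : Fin d → Fin d → Fin d → ℂ} {P z : Fin d → ℂ}
    (hsym : ∀ i k l, H i k l = H i l k) (hdiv : ∀ k, ∑ i, H i k i = 0)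
    (hlap : ∀ i, ∑ k, H i k k = z i + P i) (i : Fin d) :
    ∑ k, stressDeriv μ H P i k k = z i := by
  simp_rw [stressDeriv, Finset.sum_sub_distrib, Finset.sum_add_distrib, ← Finset.mul_sum]
  have : ∑ k, H k k i = 0 := by
    rw [← hdiv i]
    exact Finset.sum_congr rfl fun k _ => hsym k k i
  rw [this, hlap]
  simp

variable {η : EuclideanSpace ℝ (Fin d) → ℝ}

theorem pd_cutoff_stress (hη : ContDiff ℝ ∞ η) (hU : ∀ i, ContDiff ℝ ∞ (U i))
    (hφ : ContDiff ℝ ∞ φ) (i k l : Fin d) (x : EuclideanSpace ℝ (Fin d)) :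
    pd k (fun y => (η y : ℂ) * stress μ U φ i l y) x =
      η x * stressDeriv μ (fun i k l => pd k (pd l (U i)) x) (fun k => pd k φ x) i k l +
        ((pd k η x : ℝ) : ℂ) * stress μ U φ i l x := by
  rw [pd_mul (contDiff_ofReal hη) (contDiff_stress hU hφ i l), pd_ofReal hη, pd_stress hU hφ]
  ring

theorem pd_cutoff_energy (hη : ContDiff ℝ ∞ η) (hU : ∀ i, ContDiff ℝ ∞ (U i))
    (hφ : ContDiff ℝ ∞ φ) (k : Fin d) (x : EuclideanSpace ℝ (Fin d)) :
    pd k (fun y => ∑ i, (η y : ℂ) ^ 2 * ((starRingEnd ℂ) (U i y) * stress μ U φ i k y)) x =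
      ∑ i, (2 * η x * ((pd k η x : ℝ) : ℂ) * ((starRingEnd ℂ) (U i x) * stress μ U φ i k x) +
        (η x : ℂ) ^ 2 * ((starRingEnd ℂ) (pd k (U i) x) * stress μ U φ i k x)) +
      ∑ i, (η x : ℂ) ^ 2 * ((starRingEnd ℂ) (U i x) *
        stressDeriv μ (fun i k l => pd k (pd l (U i)) x) (fun k => pd k φ x) i k k) := by
  have hη2 := (contDiff_ofReal hη).pow 2
  have hT := contDiff_stress (μ := μ) hU hφ
  rw [pd_sum fun i => hη2.mul ((contDiff_conj (hU i)).mul (hT i k)), ← Finset.sum_add_distrib]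
  refine Finset.sum_congr rfl fun i _ => ?_
  have h1 : pd k (fun y => (η y : ℂ) ^ 2) x = 2 * η x * ((pd k η x : ℝ) : ℂ) := by
    simp_rw [sq]
    rw [pd_mul (contDiff_ofReal hη) (contDiff_ofReal hη), pd_ofReal hη]
    ring
  rw [pd_mul hη2 ((contDiff_conj (hU i)).mul (hT i k)), h1,
    pd_mul (contDiff_conj (hU i)) (hT i k), pd_conj (hU i), pd_stress hU hφ]
  ring

end Stress

/-! ### The localized integral estimate. -/

section LocalEstimate

variable {d : ℕ}

theorem contDiff_comp {u : EuclideanSpace ℝ (Fin d) → EuclideanSpace ℂ (Fin d)}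
    (hu : ContDiff ℝ ∞ u) (k : Fin d) : ContDiff ℝ ∞ (comp u k) :=
  ((EuclideanSpace.proj k : EuclideanSpace ℂ (Fin d) →L[ℂ] ℂ).restrictScalars ℝ).contDiff.comp hu

/-- The unit normal is a nonzero multiple of `∇ρ`, so the condition can be stated with `∇ρ` itself,
the form used for tangential fields. -/
theorem NeumannCondition.stress_normal {μ : ℝ} {Ω S V : Set (EuclideanSpace ℝ (Fin d))}
    {u : EuclideanSpace ℝ (Fin d) → EuclideanSpace ℂ (Fin d)}
    {φ : EuclideanSpace ℝ (Fin d) → ℂ} (h : NeumannCondition μ Ω S u φ)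
    {p : EuclideanSpace ℝ (Fin d)} {ρ : EuclideanSpace ℝ (Fin d) → ℝ} (hpS : p ∈ S)
    (hp : p ∈ frontier Ω) (hρ : IsLocalDefiningFunction Ω p V ρ) (i : Fin d) :
    ∑ k, stress μ (comp u) φ i k p * ((pd k ρ p : ℝ) : ℂ) = 0 := by
  have h1 := congrFun (h p hpS _ ⟨hp, V, ρ, hρ, rfl⟩) i
  have hg : ‖gradient ρ p‖ ≠ 0 := norm_ne_zero_iff.2 (hρ.gradient_ne_zero p hρ.mem)
  have hgc : ((‖gradient ρ p‖⁻¹ : ℝ) : ℂ) ≠ 0 := by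
    exact_mod_cast inv_ne_zero hg
  refine (mul_eq_zero.1 ?_).resolve_left hgc
  rw [Pi.zero_apply] at h1
  rw [← h1, Finset.mul_sum]
  simp only [Matrix.mulVec, dotProduct, Pi.sub_apply, Pi.smul_apply, Matrix.add_apply,
    Matrix.smul_apply, Matrix.transpose_apply, jacobian, Matrix.of_apply, smul_eq_mul,
    PiLp.smul_apply, gradient_apply_eq_pd, pderiv_eq_pd, stress]
  simp_rw [sub_mul, mul_sub, Finset.sum_sub_distrib]
  congr 1
  · refine Finset.sum_congr rfl fun k _ => ?_
    push_cast
    ring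
  · rw [Finset.sum_eq_single i (fun k _ hk => by simp [hk.symm]) (by simp)]
    simp
    ring

/-- Here `X` is the contraction, `D` the squared divergences and `S` the divergence of the energy
field. After integration `-(D - X)` contributes at most zero and `S` exactly zero, so only the last
term survives. -/
theorem combine_pointwise_bounds {κ a C L M D X S η e gg HH PP ZZ TT NN φ : ℝ} (hC : 0 ≤ C)
    (hL : 0 ≤ L) (hM : NN ≤ M) (he : 0 ≤ e) (hNN : 0 ≤ NN) (hgg : 0 ≤ gg)
    (hHH : 0 ≤ HH) (hPP : 0 ≤ PP) (hZZ : 0 ≤ ZZ) (hTT : 0 ≤ TT)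
    (h1 : κ * (η ^ 2 * (HH + PP)) ≤ X - D + C * (ZZ + NN * TT))
    (h2 : L * a * (η ^ 2 * gg) ≤ L * S + (1 + e) * ZZ + NN * TT)
    (h3 : TT ≤ (6 + 3 * e) * (gg + φ)) :
    min κ a * (η ^ 2 * (L * gg + HH + PP)) ≤
      -(D - X) + L * S + (C + 1 + e) * (6 + 3 * e) * (ZZ + M * (gg + φ)) := by
  have hM0 : 0 ≤ M := hNN.trans hM
  have h4 : NN * TT ≤ (6 + 3 * e) * (M * (gg + φ)) := by
    calc _ ≤ M * ((6 + 3 * e) * (gg + φ)) := by gcongr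
      _ = _ := by ring
  have h5 : 0 ≤ NN * TT := by positivity
  have h6 : min κ a * (η ^ 2 * (HH + PP)) ≤ κ * (η ^ 2 * (HH + PP)) :=
    mul_le_mul_of_nonneg_right (min_le_left _ _) (by positivity)
  have h7 : min κ a * (L * (η ^ 2 * gg)) ≤ a * (L * (η ^ 2 * gg)) :=
    mul_le_mul_of_nonneg_right (min_le_right _ _) (by positivity)
  have h8 : C * (ZZ + NN * TT) + ((1 + e) * ZZ + NN * TT) ≤
      (C + 1 + e) * (6 + 3 * e) * (ZZ + M * (gg + φ)) := by
    have a1 : 0 ≤ (5 + 3 * e) * ZZ := by positivity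
    have a2 : 0 ≤ e * (NN * TT) := by positivity
    calc _ ≤ (C + 1 + e) * (ZZ + NN * TT) := by linarith
      _ ≤ (C + 1 + e) * ((6 + 3 * e) * ZZ + (6 + 3 * e) * (M * (gg + φ))) := by
          gcongr
          linarith
      _ = _ := by ring
  linarith

/-- Pointwise coercivity of the localized contraction and of the localized energy. -/
theorem exists_pointwise_bound (d : ℕ) {μ : ℝ} (hμ : μ ∈ Set.Ioo (-1) (√2 - 1)) :
    ∃ κ K : ℝ, 0 < κ ∧ 0 < K ∧ ∀ (H : Fin d → Fin d → Fin d → ℂ) (P z u : Fin d → ℂ) (φ : ℂ)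
      (g T : Fin d → Fin d → ℂ) (η L M : ℝ) (N : Fin d → ℝ),
      (∀ i k l, H i k l = H i l k) → (∀ k, ∑ i, H i k i = 0) →
      (∀ i, ∑ k, H i k k = z i + P i) → (∑ i, g i i = 0) →
      (∀ i k, T i k = g i k + μ * g k i - if i = k then φ else 0) → η ^ 2 ≤ 1 → 0 ≤ L →
      (∀ i, ‖z i‖ = L * ‖u i‖) → ∑ k, N k ^ 2 ≤ M →
      κ * (η ^ 2 * (L * ∑ i, ∑ k, ‖g i k‖ ^ 2 + ∑ i, ∑ k, ∑ l, ‖H i k l‖ ^ 2 +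
        ∑ k, ‖P k‖ ^ 2)) ≤
        -(∑ i, ‖η * z i + ∑ k, N k * T i k‖ ^ 2 -
          (∑ i, ∑ k, ∑ l, (η * stressDeriv μ H P i k l + N k * T i l) *
            (starRingEnd ℂ) (η * stressDeriv μ H P i l k + N l * T i k)).re) +
        L * (∑ k, ∑ i, (2 * η * N k * ((starRingEnd ℂ) (u i) * T i k) +
          η ^ 2 * ((starRingEnd ℂ) (g i k) * T i k)) +
            ∑ i, η ^ 2 * ((starRingEnd ℂ) (u i) * z i)).re +
        K * (∑ i, ‖z i‖ ^ 2 + M * (∑ i, ∑ k, ‖g i k‖ ^ 2 + ‖φ‖ ^ 2)) := by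
  obtain ⟨κ, C, hκ, hC, hmain⟩ := exists_pointwise_hessian_bound d hμ
  have hs15 : √2 < 3 / 2 := by
    nlinarith [Real.sq_sqrt (show (0 : ℝ) ≤ 2 by norm_num), Real.sqrt_nonneg 2]
  have hμ1 : |μ| < 1 := abs_lt.2 ⟨hμ.1, by linarith [hμ.2]⟩
  refine ⟨min κ (1 - |μ|), (C + 1 + d) * (6 + 3 * d), lt_min hκ (by linarith), by positivity,
    fun H P z u φ g T η L M N hsym hdiv hlap hg hT hη hL hz hM => ?_⟩
  have h1 := hmain H P z T η N hsym hdiv hlap hη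
  have h2 := pointwise_gradient_bound (N := N) hL hT hg hη hz
  have h3 : ∑ i, ∑ k, ‖T i k‖ ^ 2 ≤ (6 + 3 * d) * (∑ i, ∑ k, ‖g i k‖ ^ 2 + ‖φ‖ ^ 2) := by
    simp_rw [hT]
    exact sum_norm_sq_stress_le hμ1.le g φ
  exact combine_pointwise_bounds hC.le hL hM (Nat.cast_nonneg d)
    (Finset.sum_nonneg fun _ _ => sq_nonneg _)
    (Finset.sum_nonneg fun _ _ => Finset.sum_nonneg fun _ _ => sq_nonneg _)
    (Finset.sum_nonneg fun _ _ => Finset.sum_nonneg fun _ _ => Finset.sum_nonneg fun _ _ =>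
      sq_nonneg _) (Finset.sum_nonneg fun _ _ => sq_nonneg _)
    (Finset.sum_nonneg fun _ _ => sq_nonneg _)
    (Finset.sum_nonneg fun _ _ => Finset.sum_nonneg fun _ _ => sq_nonneg _) h1 h2 h3

/-- The localized estimate in terms of a cutoff function. -/
theorem exists_local_estimate (d : ℕ) {μ : ℝ} (hμ : μ ∈ Set.Ioo (-1) (√2 - 1)) :
    ∃ κ C : ℝ, 0 < κ ∧ 0 < C ∧
      ∀ Ω : Set (EuclideanSpace ℝ (Fin d)), IsOpen Ω → Convex ℝ Ω → HasSmoothBoundary Ω →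
      ∀ (c : EuclideanSpace ℝ (Fin d)) (R : ℝ) (lam : ℂ)
        (u : EuclideanSpace ℝ (Fin d) → EuclideanSpace ℂ (Fin d))
        (φ : EuclideanSpace ℝ (Fin d) → ℂ),
        ContDiff ℝ ∞ u → ContDiff ℝ ∞ φ → SolvesStokesResolvent lam (cube c R ∩ Ω) u φ →
        NeumannCondition μ Ω (cube c R ∩ frontier Ω) u φ →
      ∀ (η : EuclideanSpace ℝ (Fin d) → ℝ) (M : ℝ), ContDiff ℝ ∞ η → HasCompactSupport η →
        tsupport η ⊆ cube c R → (∀ x, η x ^ 2 ≤ 1) → (∀ x, ∑ k, pd k η x ^ 2 ≤ M) →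
        κ * ∫ x in Ω, η x ^ 2 * (‖lam‖ * normSqGradVec u x + normSqHessVec u x + normSqGrad φ x) ≤
          C * ∫ x in cube c R ∩ Ω,
            (‖lam‖ ^ 2 * ‖u x‖ ^ 2 + M * (normSqGradVec u x + ‖φ x‖ ^ 2)) := by
  obtain ⟨κ, K, hκ, hK, hmain⟩ := exists_pointwise_bound d hμ
  refine ⟨κ, K, hκ, hK,
    fun Ω hΩ hconv hsm c R lam u φ hu hφ hsol hbc η M hη hηc hηs hη1 hM => ?_⟩
  have hU : ∀ i, ContDiff ℝ ∞ (comp u i) := contDiff_comp hu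
  set U := comp u with hUdef
  have hT : ∀ i k, ContDiff ℝ ∞ (stress μ U φ i k) := contDiff_stress hU hφ
  -- The rows of `ηT` and the energy field `w` below are tangential on all of `∂Ω`: by the boundary
  -- condition on the support of `η`, and trivially off it.
  set v : Fin d → Fin d → EuclideanSpace ℝ (Fin d) → ℂ :=
    fun i k x => (η x : ℂ) * stress μ U φ i k x with hv
  have hvs : ∀ i k, ContDiff ℝ ∞ (v i k) := fun i k => (contDiff_ofReal hη).mul (hT i k)
  have hηc' : HasCompactSupport fun x => (η x : ℂ) :=
    hηc.comp_left (g := fun r : ℝ => (r : ℂ)) (by simp)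
  have hvc : ∀ i k, HasCompactSupport (v i k) := fun i k => hηc'.mul_right
  set w : Fin d → EuclideanSpace ℝ (Fin d) → ℂ := fun k x =>
    ∑ i, (η x : ℂ) ^ 2 * ((starRingEnd ℂ) (U i x) * stress μ U φ i k x) with hw
  have hws : ∀ k, ContDiff ℝ ∞ (w k) := fun k => ContDiff.sum fun i _ =>
    ((contDiff_ofReal hη).pow 2).mul ((contDiff_conj (hU i)).mul (hT i k))
  have hη0 : ∀ x ∉ tsupport η, η x = 0 := fun x hx => image_eq_zero_of_notMem_tsupport hx
  have hwc : ∀ k, HasCompactSupport (w k) := fun k =>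
    HasCompactSupport.intro hηc fun x hx => Finset.sum_eq_zero fun i _ => by simp [hη0 x hx]
  have hout : ∀ {f : EuclideanSpace ℝ (Fin d) → ℂ}, (∀ x, η x = 0 → f x = 0) →
      ∀ x ∉ tsupport η, ∀ k, pd k f x = 0 := by
    intro f hf x hx k
    refine pd_zero_of_notMem_tsupport fun h => hx ?_
    refine closure_mono (fun y hy => ?_) h
    exact fun h0 => hy (hf y h0)
  have hTn : ∀ p ∈ frontier Ω, ∀ V ρ, IsLocalDefiningFunction Ω p V ρ → p ∈ cube c R →
      ∀ i, ∑ k, stress μ U φ i k p * ((pd k ρ p : ℝ) : ℂ) = 0 := fun p hp V ρ hρ hpc i =>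
    hbc.stress_normal ⟨hpc, hp⟩ hp hρ i
  have hvn : ∀ i, ∀ p ∈ frontier Ω, ∀ V ρ, IsLocalDefiningFunction Ω p V ρ →
      ∑ k, v i k p * ((pd k ρ p : ℝ) : ℂ) = 0 := by
    intro i p hp V ρ hρ
    simp only [hv, mul_assoc, ← Finset.mul_sum]
    by_cases hpt : p ∈ tsupport η
    · rw [hTn p hp V ρ hρ (hηs hpt), mul_zero]
    · simp [hη0 p hpt]
  have hwn : ∀ p ∈ frontier Ω, ∀ V ρ, IsLocalDefiningFunction Ω p V ρ →
      ∑ k, (w k p).re * pd k ρ p = 0 := by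
    intro p hp V ρ hρ
    have h1 : ∑ k, w k p * ((pd k ρ p : ℝ) : ℂ) = 0 := by
      simp only [hw, Finset.sum_mul]
      rw [Finset.sum_comm]
      refine Finset.sum_eq_zero fun i _ => ?_
      simp only [mul_assoc, ← Finset.mul_sum]
      by_cases hpt : p ∈ tsupport η
      · rw [hTn p hp V ρ hρ (hηs hpt), mul_zero, mul_zero]
      · simp [hη0 p hpt]
    simpa using congrArg Complex.re h1
  set con : Fin d → EuclideanSpace ℝ (Fin d) → ℝ := fun i x => ‖∑ k, pd k (v i k) x‖ ^ 2 -
      (∑ k, ∑ l, pd k (v i l) x * (starRingEnd ℂ) (pd l (v i k) x)).re with hcon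
  have hcon0 : ∀ i, 0 ≤ ∫ x in Ω, con i x := fun i =>
    integral_contraction_complex_nonneg hΩ hsm hconv (hvs i) (hvc i) (hvn i)
  have hconi : ∀ i, Integrable (con i) := fun i =>
    integrable_contraction_complex (hvs i) (hvc i)
  set S : EuclideanSpace ℝ (Fin d) → ℝ := fun x => ∑ k, pd k (fun y => (w k y).re) x with hS
  have hS0 : ∫ x in Ω, S x = 0 :=
    integral_divergence_eq_zero hΩ hsm (fun k => contDiff_re (hws k))
      (fun k => hasCompactSupport_re (hwc k)) hwn
  have hSi : Integrable S := integrable_finsetSum _ fun k _ =>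
    (contDiff_pd (contDiff_re (hws k))).continuous.integrable_of_hasCompactSupport
      (hasCompactSupport_pd (hasCompactSupport_re (hwc k)))
  have hgc : Continuous (normSqGradVec u) := continuous_finsetSum _ fun k _ =>
    continuous_finsetSum _ fun j _ => (contDiff_pd (hU k)).continuous.norm.pow 2
  have hhc : Continuous (normSqHessVec u) := continuous_finsetSum _ fun k _ =>
    continuous_finsetSum _ fun i _ => continuous_finsetSum _ fun j _ =>
      (contDiff_pd (contDiff_pd (hU k))).continuous.norm.pow 2
  have hpc : Continuous (normSqGrad φ) := continuous_finsetSum _ fun k _ =>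
    (contDiff_pd hφ).continuous.norm.pow 2
  have hηcont := hη.continuous
  have hucont := hu.continuous
  have hφcont := hφ.continuous
  set G : EuclideanSpace ℝ (Fin d) → ℝ := fun x =>
    ‖lam‖ ^ 2 * ‖u x‖ ^ 2 + M * (normSqGradVec u x + ‖φ x‖ ^ 2) with hG
  have hGc : Continuous G := by fun_prop
  set B := cube c R with hB
  have hBo : IsOpen B := isOpen_cube c R
  -- Inside the cube the equations hold and the pointwise bound applies. Outside it `x` is off the
  -- support of `η` and every term vanishes.
  have hpoint : ∀ x ∈ Ω, κ *
      (η x ^ 2 * (‖lam‖ * normSqGradVec u x + normSqHessVec u x + normSqGrad φ x)) ≤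
      -(∑ i, con i x) + ‖lam‖ * S x + K * B.indicator G x := by
    intro x hxΩ
    by_cases hxB : x ∈ B
    · have hBΩ : IsOpen (B ∩ Ω) := hBo.inter hΩ
      set H : Fin d → Fin d → Fin d → ℂ := fun i k l => pd k (pd l (U i)) x with hH
      set P : Fin d → ℂ := fun k => pd k φ x with hP
      set z : Fin d → ℂ := fun i => lam * U i x with hz
      have hsym : ∀ i k l, H i k l = H i l k := fun i k l => pd_comm (hU i) x
      have hdivx : ∑ i, pd i (U i) x = 0 := (hsol x ⟨hxB, hxΩ⟩).2
      have hdiv : ∀ k, ∑ i, H i k i = 0 := by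
        intro k
        -- `div u = 0` may be differentiated because it holds on the open set `B ∩ Ω`.
        have h1 : pd k (fun y => ∑ i, pd i (U i) y) x = pd k (fun _ => (0 : ℂ)) x :=
          pd_congr hBΩ (fun y hy => (hsol y hy).2) ⟨hxB, hxΩ⟩
        rw [pd_sum fun i => contDiff_pd (hU i), pd_const] at h1
        exact h1
      have hlap : ∀ i, ∑ k, H i k k = z i + P i := by
        intro i
        have h1 := (hsol x ⟨hxB, hxΩ⟩).1 i
        rw [laplacian_eq_sum_pd (hU i)] at h1
        change lam * U i x - ∑ k, H i k k + P i = 0 at h1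
        simp only [hz]
        linear_combination -h1
      set T : Fin d → Fin d → ℂ := fun i k => stress μ U φ i k x with hTd
      set N : Fin d → ℝ := fun k => pd k η x with hN
      have h1 := hmain H P z (fun i => U i x) (φ x) (fun i k => pd k (U i) x) T (η x) ‖lam‖ M N
        hsym hdiv hlap hdivx (fun i k => rfl) (hη1 x) (norm_nonneg _) (fun i => norm_mul _ _) (hM x)
      have hconx : ∑ i, con i x = ∑ i, ‖η x * z i + ∑ k, N k * T i k‖ ^ 2 -
          (∑ i, ∑ k, ∑ l, (η x * stressDeriv μ H P i k l + N k * T i l) *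
            (starRingEnd ℂ) (η x * stressDeriv μ H P i l k + N l * T i k)).re := by
        have hvx : ∀ i k l, pd k (v i l) x =
            η x * stressDeriv μ H P i k l + N k * T i l := fun i k l =>
          pd_cutoff_stress hη hU hφ i k l x
        rw [Complex.re_sum, ← Finset.sum_sub_distrib]
        refine Finset.sum_congr rfl fun i _ => ?_
        simp only [hcon, hvx]
        rw [Finset.sum_add_distrib, ← Finset.mul_sum, sum_stressDeriv_diag hsym hdiv hlap]
      have hSx : S x = (∑ k, ∑ i, (2 * η x * N k * ((starRingEnd ℂ) (U i x) * T i k) +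
          η x ^ 2 * ((starRingEnd ℂ) (pd k (U i) x) * T i k)) +
            ∑ i, η x ^ 2 * ((starRingEnd ℂ) (U i x) * z i)).re := by
        have hwx : ∀ k, pd k (fun y => (w k y).re) x = _ := fun k =>
          (pd_re (hws k) x).trans (congrArg Complex.re (pd_cutoff_energy hη hU hφ k x))
        simp only [hS, hwx]
        rw [← Complex.re_sum, Finset.sum_add_distrib]
        congr 2
        rw [Finset.sum_comm]
        refine Finset.sum_congr rfl fun i _ => ?_
        simp_rw [← Finset.mul_sum]
        rw [sum_stressDeriv_diag hsym hdiv hlap]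
      rw [hconx, hSx, Set.indicator_of_mem hxB]
      have hnu : ‖lam‖ ^ 2 * ‖u x‖ ^ 2 = ∑ i, ‖z i‖ ^ 2 := by
        rw [EuclideanSpace.norm_sq_eq, Finset.mul_sum]
        refine Finset.sum_congr rfl fun i _ => ?_
        rw [← mul_pow, ← norm_mul]
        rfl
      have hgr : normSqGradVec u x = ∑ i, ∑ k, ‖pd k (U i) x‖ ^ 2 := rfl
      have hhr : normSqHessVec u x = ∑ i, ∑ k, ∑ l, ‖H i k l‖ ^ 2 := rfl
      have hpr : normSqGrad φ x = ∑ k, ‖P k‖ ^ 2 := rfl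
      simp only [hG]
      rw [hnu, hgr, hhr, hpr]
      exact h1
    · have hxt : x ∉ tsupport η := fun h => hxB (hηs h)
      have hvx : ∀ i k l, pd k (v i l) x = 0 := fun i k l =>
        hout (fun y hy => by simp [hv, hy]) x hxt k
      have hwx : ∀ k, pd k (fun y => (w k y).re) x = 0 := fun k => by
        rw [pd_re (hws k), hout (fun y hy => by simp [hw, hy]) x hxt k, Complex.zero_re]
      have hSx : S x = 0 := Finset.sum_eq_zero fun k _ => hwx k
      have hcx : ∀ i, con i x = 0 := fun i => by simp [hcon, hvx]
      simp [hη0 x hxt, hSx, hcx, hxB]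
  have hGB : IntegrableOn (B.indicator G) Ω := by
    refine Integrable.integrableOn ?_
    rw [integrable_indicator_iff hBo.measurableSet]
    simpa using integrableOn_cube hGc c R Set.univ
  have hLint : IntegrableOn (fun x => κ *
      (η x ^ 2 * (‖lam‖ * normSqGradVec u x + normSqHessVec u x + normSqGrad φ x))) Ω := by
    refine (Continuous.integrable_of_hasCompactSupport (by fun_prop)
      (HasCompactSupport.intro hηc fun x hx => ?_)).integrableOn
    simp [hη0 x hx]
  have hconI : IntegrableOn (fun x => -∑ i, con i x) Ω :=
    (integrable_finsetSum _ fun i _ => hconi i).neg.integrableOn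
  have hSI : IntegrableOn (fun x => ‖lam‖ * S x) Ω := (hSi.const_mul _).integrableOn
  have hGI : IntegrableOn (fun x => K * B.indicator G x) Ω := hGB.const_mul K
  have hfin := setIntegral_mono_on hLint ((hconI.add hSI).add hGI) hΩ.measurableSet hpoint
  have e1 : ∫ x in Ω, (((fun x => -∑ i, con i x) + fun x => ‖lam‖ * S x) +
      fun x => K * B.indicator G x) x =
      -(∑ i, ∫ x in Ω, con i x) + ‖lam‖ * (∫ x in Ω, S x) + K * ∫ x in B ∩ Ω, G x := by
    rw [integral_add' (hconI.add hSI) hGI, integral_add' hconI hSI, integral_neg,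
      integral_finsetSum _ fun i _ => (hconi i).integrableOn, integral_const_mul,
      integral_const_mul, setIntegral_indicator hBo.measurableSet, Set.inter_comm]
  have hsum := Finset.sum_nonneg fun i (_ : i ∈ Finset.univ) => hcon0 i
  rw [integral_const_mul] at hfin
  have hfin' := hfin.trans_eq e1
  rw [hS0] at hfin'
  linarith

end LocalEstimate

end StokesNeumann

/-- The functions `u` and `φ` are smooth up to the boundary of `(2𝒬) ∩ Ω`, that is, they are the
restrictions to `(2𝒬) ∩ Ω` of smooth functions on `ℝ^d`; they enter the hypotheses and the
conclusion only through their values on `(2𝒬) ∩ Ω` and the continuous extensions of these values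
and of their derivatives to the boundary. -/
theorem proposition4p9 (d : ℕ) (hd : 2 ≤ d) (θ : ℝ) (hθ : θ ∈ Set.Ioo 0 Real.pi)
    (μ : ℝ) (hμ : μ ∈ Set.Ioo (-1) (√2 - 1)) :
    ∃ C : ℝ, 0 < C ∧
      ∀ Ω : Set (EuclideanSpace ℝ (Fin d)),
        IsOpen Ω → Bornology.IsBounded Ω → Convex ℝ Ω → StokesNeumann.HasSmoothBoundary Ω →
      ∀ (c : EuclideanSpace ℝ (Fin d)) (R : ℝ), 0 < R →
        (StokesNeumann.cube c R ∩ Ω).Nonempty →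
      ∀ lam ∈ StokesNeumann.sector θ,
      ∀ (u : EuclideanSpace ℝ (Fin d) → EuclideanSpace ℂ (Fin d))
        (φ : EuclideanSpace ℝ (Fin d) → ℂ),
        ContDiff ℝ (⊤ : ℕ∞) u → ContDiff ℝ (⊤ : ℕ∞) φ →
        StokesNeumann.SolvesStokesResolvent lam (StokesNeumann.cube c (2 * R) ∩ Ω) u φ →
        StokesNeumann.NeumannCondition μ Ω (StokesNeumann.cube c (2 * R) ∩ frontier Ω) u φ →
        ‖lam‖ * (∫ x in StokesNeumann.cube c R ∩ Ω, StokesNeumann.normSqGradVec u x)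
            + (∫ x in StokesNeumann.cube c R ∩ Ω, StokesNeumann.normSqHessVec u x)
            + (∫ x in StokesNeumann.cube c R ∩ Ω, StokesNeumann.normSqGrad φ x)
          ≤ C * (‖lam‖ ^ 2 * (∫ x in StokesNeumann.cube c (2 * R) ∩ Ω, ‖u x‖ ^ 2)
            + 1 / R ^ 2 * (∫ x in StokesNeumann.cube c (2 * R) ∩ Ω,
                (StokesNeumann.normSqGradVec u x + ‖φ x‖ ^ 2))) := by
  obtain ⟨κ, C, hκ, hC, hest⟩ := StokesNeumann.exists_local_estimate d hμ
  obtain ⟨M, hM, hcut⟩ := StokesNeumann.exists_cutoff (show 0 < d by omega)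
  -- `M` comes from `|∇η|² ≤ M / R²`; the maximum with `1` also covers the coefficient of the term
  -- with `|u|²`.
  refine ⟨C / κ * max 1 M, by positivity,
    fun Ω hΩ _ hconv hsm c R hR _ lam _ u φ hu hφ hsol hbc => ?_⟩
  obtain ⟨η, hη, hηc, hηs, hη1, hηle, hηM⟩ := hcut c R hR
  have h1 := hest Ω hΩ hconv hsm c (2 * R) lam u φ hu hφ hsol hbc η (M / R ^ 2) hη hηc hηs
    hηle hηM
  have hU := StokesNeumann.contDiff_comp hu
  have hgc : Continuous (StokesNeumann.normSqGradVec u) := continuous_finsetSum _ fun k _ =>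
    continuous_finsetSum _ fun j _ => (StokesNeumann.contDiff_pd (hU k)).continuous.norm.pow 2
  have hhc : Continuous (StokesNeumann.normSqHessVec u) := continuous_finsetSum _ fun k _ =>
    continuous_finsetSum _ fun i _ => continuous_finsetSum _ fun j _ =>
      (StokesNeumann.contDiff_pd (StokesNeumann.contDiff_pd (hU k))).continuous.norm.pow 2
  have hpc : Continuous (StokesNeumann.normSqGrad φ) := continuous_finsetSum _ fun k _ =>
    (StokesNeumann.contDiff_pd hφ).continuous.norm.pow 2
  have hucont := hu.continuous
  have hφcont := hφ.continuous
  have hηcont := hη.continuous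
  have hg0 : ∀ x, 0 ≤ StokesNeumann.normSqGradVec u x := fun x => Finset.sum_nonneg fun _ _ =>
    Finset.sum_nonneg fun _ _ => by positivity
  have hh0 : ∀ x, 0 ≤ StokesNeumann.normSqHessVec u x := fun x => Finset.sum_nonneg fun _ _ =>
    Finset.sum_nonneg fun _ _ => Finset.sum_nonneg fun _ _ => by positivity
  have hp0 : ∀ x, 0 ≤ StokesNeumann.normSqGrad φ x := fun x => Finset.sum_nonneg fun _ _ => by
    positivity
  set Q := StokesNeumann.cube c R with hQ
  set F := fun x => ‖lam‖ * StokesNeumann.normSqGradVec u x + StokesNeumann.normSqHessVec u x +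
    StokesNeumann.normSqGrad φ x with hF
  have hF0 : ∀ x, 0 ≤ F x := fun x =>
    add_nonneg (add_nonneg (mul_nonneg (norm_nonneg _) (hg0 x)) (hh0 x)) (hp0 x)
  have hQo : IsOpen Q := StokesNeumann.isOpen_cube c R
  have e1 : ‖lam‖ * (∫ x in Q ∩ Ω, StokesNeumann.normSqGradVec u x)
      + (∫ x in Q ∩ Ω, StokesNeumann.normSqHessVec u x)
      + (∫ x in Q ∩ Ω, StokesNeumann.normSqGrad φ x) = ∫ x in Q ∩ Ω, F x := by
    have i1 : MeasureTheory.IntegrableOn (fun x => ‖lam‖ * StokesNeumann.normSqGradVec u x)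
        (Q ∩ Ω) := StokesNeumann.integrableOn_cube (by fun_prop) c R Ω
    have i2 := StokesNeumann.integrableOn_cube hhc c R Ω
    have i3 := StokesNeumann.integrableOn_cube hpc c R Ω
    simp only [hF]
    have i12 : MeasureTheory.IntegrableOn (fun x => ‖lam‖ * StokesNeumann.normSqGradVec u x +
        StokesNeumann.normSqHessVec u x) (Q ∩ Ω) := i1.add i2
    rw [MeasureTheory.integral_add i12 i3, MeasureTheory.integral_add i1 i2,
      MeasureTheory.integral_const_mul]
  have e2 : ∫ x in Q ∩ Ω, F x = ∫ x in Q ∩ Ω, η x ^ 2 * F x :=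
    MeasureTheory.setIntegral_congr_fun (hQo.inter hΩ).measurableSet fun x hx => by
      simp [hη1 x hx.1]
  have e3 : ∫ x in Q ∩ Ω, η x ^ 2 * F x ≤ ∫ x in Ω, η x ^ 2 * F x := by
    refine MeasureTheory.setIntegral_mono_set ?_
      (Filter.Eventually.of_forall fun x => mul_nonneg (sq_nonneg _) (hF0 x))
      (Filter.Eventually.of_forall fun x hx => hx.2)
    refine (Continuous.integrable_of_hasCompactSupport (by fun_prop)
      (HasCompactSupport.intro hηc fun x hx => ?_)).integrableOn
    simp [image_eq_zero_of_notMem_tsupport hx]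
  have e4 : ∫ x in StokesNeumann.cube c (2 * R) ∩ Ω, (‖lam‖ ^ 2 * ‖u x‖ ^ 2 +
      M / R ^ 2 * (StokesNeumann.normSqGradVec u x + ‖φ x‖ ^ 2)) =
      ‖lam‖ ^ 2 * (∫ x in StokesNeumann.cube c (2 * R) ∩ Ω, ‖u x‖ ^ 2) +
      M / R ^ 2 * (∫ x in StokesNeumann.cube c (2 * R) ∩ Ω,
                (StokesNeumann.normSqGradVec u x + ‖φ x‖ ^ 2)) := by
    rw [MeasureTheory.integral_add, MeasureTheory.integral_const_mul,
      MeasureTheory.integral_const_mul]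
    · exact StokesNeumann.integrableOn_cube (by fun_prop) c (2 * R) Ω
    · exact StokesNeumann.integrableOn_cube (by fun_prop) c (2 * R) Ω
  rw [e4] at h1
  rw [e1, e2]
  refine e3.trans ?_
  set A1 := ‖lam‖ ^ 2 * (∫ x in StokesNeumann.cube c (2 * R) ∩ Ω, ‖u x‖ ^ 2) with hA1
  set A2 := ∫ x in StokesNeumann.cube c (2 * R) ∩ Ω,
    (StokesNeumann.normSqGradVec u x + ‖φ x‖ ^ 2) with hA2
  have hA10 : 0 ≤ A1 := mul_nonneg (sq_nonneg _)
    (MeasureTheory.integral_nonneg fun x => sq_nonneg _)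
  have hA20 : 0 ≤ A2 := MeasureTheory.integral_nonneg fun x => add_nonneg (hg0 x) (sq_nonneg _)
  have h2 : A1 + M / R ^ 2 * A2 ≤ max 1 M * (A1 + 1 / R ^ 2 * A2) := by
    have b1 : 1 * A1 ≤ max 1 M * A1 := mul_le_mul_of_nonneg_right (le_max_left _ _) hA10
    have b2 : M * (1 / R ^ 2 * A2) ≤ max 1 M * (1 / R ^ 2 * A2) :=
      mul_le_mul_of_nonneg_right (le_max_right _ _) (by positivity)
    have b3 : M / R ^ 2 * A2 = M * (1 / R ^ 2 * A2) := by ring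
    linarith
  calc ∫ x in Ω, η x ^ 2 * F x = κ * (∫ x in Ω, η x ^ 2 * F x) / κ := by field_simp
    _ ≤ C * (A1 + M / R ^ 2 * A2) / κ := by gcongr
    _ ≤ C * (max 1 M * (A1 + 1 / R ^ 2 * A2)) / κ := by gcongr
    _ = _ := by ring
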